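/- All matrices are complex $n\times n$ matrices and $\|\cdot\|$ is the operator norm induced by the Euclidean norm. For a matrix $T$ with no eigenvalue on $i\mathbb R$, $\operatorname{sign}(T)$ is defined by the holomorphic functional calculus applied to the function equal to $+1$ on $\{\operatorname{Re}z>0\}$ and to $-1$ on $\{\operatorname{Re}z<0\}$. For $z\in\mathbb C$, $h>0$ and an integer $K\ge1$ put $$F_M(z)=\frac1\pi e^z\Big((M-ie^zI)^{-1}+(M+ie^zI)^{-1}\Big),\qquad t_k=e^{kh},$$ $$S_{K,h}(M)=h\sum_{k=-K}^{K}F_M(kh)=\frac h\pi\sum_{k=-K}^{K}t_k\Big((M-it_kI)^{-1}+(M+it_kI)^{-1}\Big).$$ **Theorem (log-sinc sign approximation).** Let $M$ be a complex $n\times n$ matrix with $\|M\|\le1$, let $a\in(0,1)$, and let $\gamma$ be a real number with $$\gamma\ \ge\ \sup_{|\operatorname{Re}z|\le a}\|(zI-M)^{-1}\|$$ (in particular $zI-M$ is invertible whenever $|\operatorname{Re}z|\le a$). Let $0<\beta<\arcsin a$, and put $$C=\frac4\pi\Big(\frac{a\gamma}{\sin\beta}+\frac{\sin\beta}{a-\sin\beta}\Big),\qquad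 \widetilde C=2C+\frac{2\gamma+4}{\pi}>0 .$$ Then: 1. For $|\operatorname{Im}z|<\beta$ the matrices $M\pm ie^zI$ are invertible; $F_M$ is holomorphic on $\{|\operatorname{Im}z|<\beta\}$ and integrable on $\mathbb R$, and $\operatorname{sign}(M)=\int_{-\infty}^{\infty}F_M(x)\,dx$. 2. For every $h>0$ and every integer $K\ge1$, $$\|\operatorname{sign}(M)-S_{K,h}(M)\|\le\frac{C}{e^{2\pi\beta/h}-1}+\frac{2\gamma}{\pi}e^{-Kh}+\frac{2}{\pi(e^{Kh}-1)} .$$ 3. For every integer $K\ge1$, with the balanced step $h=\sqrt{2\pi\beta/K}$, $$\|\operatorname{sign}(M)-S_{K,h}(M)\|\le\widetilde C\,e^{-\sqrt{2\pi\beta K}} .$$ 4. For every $\varepsilon>0$, every integer $$K\ge\Big\lceil\frac1{2\pi\beta}\max\big\{(\log2)^2,\ \log^2(1+\widetilde C/\varepsilon)\big\}\Big\rceil ,$$ with $h=\sqrt{2\pi\beta/K}$, gives $\|\operatorname{sign}(M)-S_{K,h}(M)\|\le\varepsilon$. 5. There is an absolute constant $c>0$ (independent of $n,M,a,\gamma,\beta,\varepsilon$)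 such that for every $\varepsilon>0$ there is an integer $K_0$ with $1\le K_0\le\max\{1,\ \frac c\beta\log^2(\widetilde C/\varepsilon)\}$ such that every integer $K\ge K_0$, with $h=\sqrt{2\pi\beta/K}$, gives $\|\operatorname{sign}(M)-S_{K,h}(M)\|\le\varepsilon$. That is, $K=O\big(\tfrac1\beta\log^2(\widetilde C/\varepsilon)\big)$ suffices. -/

import Mathlib

open scoped Matrix.Norms.L2Operator

noncomputable section

/- All matrix norms below are operator norms with respect to the Euclidean vector norm
(the scope `Matrix.Norms.L2Operator` opened above). -/

namespace LogSinc

/-- The scalar half-plane sign: `1` on `Re z > 0`, `-1` on `Re z < 0`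
(the value on the imaginary axis is irrelevant and set to `0`). -/
def halfPlaneSign (z : ℂ) : ℂ :=
  if 0 < z.re then 1 else if z.re < 0 then -1 else 0

/-- The cycle integral `(2πi)⁻¹ ∑_{μ ∈ spec T} ∮_{|z - μ| = r} f(z) (zI - T)⁻¹ dz`. -/
def dunfordIntegral {n : ℕ} (f : ℂ → ℂ) (T : Matrix (Fin n) (Fin n) ℂ) (r : ℝ) :
    Matrix (Fin n) (Fin n) ℂ :=
  (2 * (Real.pi : ℂ) * Complex.I)⁻¹ •
    ∑ᶠ μ ∈ spectrum ℂ T,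
      ∮ z in C(μ, r), f z • (z • (1 : Matrix (Fin n) (Fin n) ℂ) - T)⁻¹

/-- The holomorphic (Riesz-Dunford) functional calculus `f(T)` of a matrix `T`, for `f` holomorphic
near the spectrum of `T`. The contour consists of one circle of radius `r` around every point of
the (finite) spectrum; by Cauchy's theorem the integral does not depend on `r` once `r` is
small, and `f(T)` is this common value. -/
def holomorphicCalculus {n : ℕ} (f : ℂ → ℂ) (T : Matrix (Fin n) (Fin n) ℂ) :
    Matrix (Fin n) (Fin n) ℂ :=
  Filter.limUnder (nhdsWithin (0 : ℝ) (Set.Ioi 0)) (dunfordIntegral f T)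

/-- The matrix sign function `sign(T)`, for `T` without spectrum on the imaginary axis. -/
def matrixSign {n : ℕ} (T : Matrix (Fin n) (Fin n) ℂ) : Matrix (Fin n) (Fin n) ℂ :=
  holomorphicCalculus halfPlaneSign T

/-- `γ ≥ sup_{|Re z| ≤ a} ‖(zI - M)⁻¹‖`, where the supremum is finite only if `zI - M` is
invertible for every `z` in the closed strip `|Re z| ≤ a`. -/
def StripResolventBound {n : ℕ} (M : Matrix (Fin n) (Fin n) ℂ) (a γ : ℝ) : Prop :=
  ∀ z : ℂ, |z.re| ≤ a →
    IsUnit (z • (1 : Matrix (Fin n) (Fin n) ℂ) - M) ∧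
      ‖(z • (1 : Matrix (Fin n) (Fin n) ℂ) - M)⁻¹‖ ≤ γ

/-- `F_M(z) = π⁻¹ e^z ((M - i e^z I)⁻¹ + (M + i e^z I)⁻¹)`. -/
def logIntegrand {n : ℕ} (M : Matrix (Fin n) (Fin n) ℂ) (z : ℂ) : Matrix (Fin n) (Fin n) ℂ :=
  ((Real.pi : ℂ)⁻¹ * Complex.exp z) •
    ((M - (Complex.I * Complex.exp z) • (1 : Matrix (Fin n) (Fin n) ℂ))⁻¹ +
      (M + (Complex.I * Complex.exp z) • (1 : Matrix (Fin n) (Fin n) ℂ))⁻¹)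

/-- The logarithmic sinc nodes `t_k = e^{kh}`. -/
def node (h : ℝ) (k : ℤ) : ℝ := Real.exp (k * h)

/-- The truncated log-sinc sum
`S_{K,h}(M) = (h/π) ∑_{k=-K}^{K} t_k ((M - i t_k I)⁻¹ + (M + i t_k I)⁻¹)`. -/
def logSincSum {n : ℕ} (K : ℕ) (h : ℝ) (M : Matrix (Fin n) (Fin n) ℂ) :
    Matrix (Fin n) (Fin n) ℂ :=
  ((h / Real.pi : ℝ) : ℂ) •
    ∑ k ∈ Finset.Icc (-(K : ℤ)) (K : ℤ),
      (node h k : ℂ) •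
        ((M - (Complex.I * (node h k : ℂ)) • (1 : Matrix (Fin n) (Fin n) ℂ))⁻¹ +
          (M + (Complex.I * (node h k : ℂ)) • (1 : Matrix (Fin n) (Fin n) ℂ))⁻¹)

/-- `C_{β,a,γ}`. -/
def stripConst (β a γ : ℝ) : ℝ :=
  4 / Real.pi * (a * γ / Real.sin β + Real.sin β / (a - Real.sin β))

/-- The explicit error bound `ε(K, h; β, a, γ)`. -/
def sincError (K : ℕ) (h β a γ : ℝ) : ℝ :=
  stripConst β a γ / (Real.exp (2 * Real.pi * β / h) - 1)
    + 2 * γ / Real.pi * Real.exp (-(K * h))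
    + 2 / (Real.pi * (Real.exp (K * h) - 1))

/-- The constant of the balanced bound, `2 C_{β,a,γ} + (2γ + 4)/π`. -/
def signConst (β a γ : ℝ) : ℝ :=
  2 * stripConst β a γ + (2 * γ + 4) / Real.pi

/-- The balanced step `h = √(2πβ/K)`. -/
def balancedStep (β : ℝ) (K : ℕ) : ℝ := Real.sqrt (2 * Real.pi * β / K)

end LogSinc

end

/-! Two independent facts combine. The first is exactness: `sign(M)` equals `∫ F_M`. By
Cayley-Hamilton the resolvent is, off the spectrum, a finite sum of terms `(z - ν)⁻¹ ^ (j + 1) • A`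
with `ν` an eigenvalue (`exists_polarParts_resolvent`). For each scalar factor the cycle integral
follows from residues and the line integral from an explicit primitive. Both give `halfPlaneSign ν`
when `j = 0` and `0` when `j ≥ 1` (`signFormula_inv_pow`), so no contour has to be deformed from one
to the other.

The second is the accuracy of the trapezoidal rule in a strip. Poisson summation expresses the
discretisation error by the Fourier transform at the nonzero multiples of `1/h`, and moving the line
of integration by `β` makes these values of size `e^{-2πβ|k|/h}`. The constant is the integral of a
majorant of `F_M` on the strip. As long as `e^x sin β ≤ a`, the points `± i e^z` stay in `|Re| ≤ a`
and `γ` controls both resolvents; beyond that, `‖M‖ ≤ 1` and the cancellation between the two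
resolvents give decay `e^{-x}`. The same estimates on the real axis bound the two tails.

The balanced step makes `Kh` and `2πβ/h` both equal to `√(2πβK)`. The general bound blows up as `Kh
→ 0`, so it is used only for `Kh ≥ log 2`. For `Kh ≤ log 2` the integral and the sum are bounded
separately, and `le_signConst` shows by completing a square that `signConst` dominates the result.
-/

namespace LogSinc

open MeasureTheory Filter Topology Real Set

/-! ### The trapezoidal rule for functions holomorphic in a strip. -/

section Strip

variable {E : Type*} [NormedAddCommGroup E]

theorem integrable_exp_neg_mul_abs {c : ℝ} (hc : 0 < c) :
    Integrable (fun x : ℝ => Real.exp (-(c * |x|))) := by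
  rw [← integrableOn_univ, ← Iic_union_Ioi (a := (0 : ℝ))]
  refine IntegrableOn.union ?_ ?_
  · refine (integrableOn_exp_mul_Iic hc 0).congr_fun (fun x hx => ?_) measurableSet_Iic
    simp [abs_of_nonpos (mem_Iic.1 hx)]
  · refine (exp_neg_integrableOn_Ioi 0 hc).congr_fun (fun x hx => ?_) measurableSet_Ioi
    simp [abs_of_pos (mem_Ioi.1 hx)]

variable [NormedSpace ℂ E]

theorem continuous_comp_horizontal {f : ℂ → E} {β y : ℝ}
    (hd : DifferentiableOn ℂ f {z | |z.im| ≤ β}) (hy : |y| ≤ β) :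
    Continuous fun x : ℝ => f (x + y * Complex.I) := by
  refine hd.continuousOn.comp_continuous (by fun_prop) fun x => ?_
  simpa using hy

theorem integrable_horizontal {f : ℂ → E} {β y c A : ℝ} (hc : 0 < c)
    (hd : DifferentiableOn ℂ f {z | |z.im| ≤ β})
    (hb : ∀ z : ℂ, |z.im| ≤ β → ‖f z‖ ≤ A * Real.exp (-(c * |z.re|))) (hy : |y| ≤ β) :
    Integrable fun x : ℝ => f (x + y * Complex.I) := by
  refine ((integrable_exp_neg_mul_abs hc).const_mul A).mono'
    (continuous_comp_horizontal hd hy).aestronglyMeasurable (ae_of_all _ fun x => ?_)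
  simpa using hb (x + y * Complex.I) (by simpa using hy)

/-- Cauchy's theorem on the rectangle with real parts in `[-T, T]`; the vertical sides vanish as `T
→ ∞` by the exponential bound. -/
theorem integral_horizontal_eq {f : ℂ → E} {β y c A : ℝ} (hc : 0 < c)
    (hd : DifferentiableOn ℂ f {z | |z.im| ≤ β})
    (hb : ∀ z : ℂ, |z.im| ≤ β → ‖f z‖ ≤ A * Real.exp (-(c * |z.re|))) (hy : |y| ≤ β) :
    ∫ x : ℝ, f x = ∫ x : ℝ, f (x + y * Complex.I) := by
  have h0 : |(0 : ℝ)| ≤ β := by simpa using (abs_nonneg y).trans hy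
  have hlim : ∀ {v : ℝ}, |v| ≤ β → Tendsto (fun T : ℝ => ∫ x in (-T)..T, f (x + v * Complex.I))
      atTop (𝓝 (∫ x : ℝ, f (x + v * Complex.I))) := fun hv =>
    intervalIntegral_tendsto_integral (integrable_horizontal hc hd hb hv)
      tendsto_neg_atTop_atBot tendsto_id
  have hseg : ∀ {v : ℝ}, v ∈ uIcc 0 y → |v| ≤ β := fun {v} hv =>
    (by simpa using abs_sub_left_of_mem_uIcc hv : |v| ≤ |y|).trans hy
  have hside : ∀ u : ℝ → ℝ, (∀ T, |u T| = |T|) →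
      Tendsto (fun T : ℝ => ∫ v in (0 : ℝ)..y, f (u T + v * Complex.I)) atTop (𝓝 0) := by
    intro u hu
    have hz : Tendsto (fun T : ℝ => A * Real.exp (-(c * |T|)) * |y - 0|) atTop (𝓝 0) := by
      have : Tendsto (fun T : ℝ => Real.exp (-(c * |T|))) atTop (𝓝 0) :=
        tendsto_exp_neg_atTop_nhds_zero.comp (tendsto_abs_atTop_atTop.const_mul_atTop hc)
      simpa using (this.const_mul A).mul_const |y - 0|
    refine squeeze_zero_norm (fun T => ?_) hz
    refine intervalIntegral.norm_integral_le_of_norm_le_const fun v hv => ?_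
    simpa [hu] using hb (u T + v * Complex.I) (by simpa using hseg (uIoc_subset_uIcc hv))
  have key : ∀ T : ℝ, ((∫ x in (-T)..T, f (x + (0 : ℝ) * Complex.I)) -
      ∫ x in (-T)..T, f (x + y * Complex.I)) +
      Complex.I • (∫ v in (0 : ℝ)..y, f (T + v * Complex.I)) -
      Complex.I • (∫ v in (0 : ℝ)..y, f ((-T : ℝ) + v * Complex.I)) = 0 := by
    intro T
    have := Complex.integral_boundary_rect_eq_zero_of_differentiableOn f ((-T : ℝ) : ℂ)
      (T + y * Complex.I) (hd.mono ?_)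
    · simpa using this
    · rintro z ⟨-, hz⟩
      exact hseg (by simpa using hz)
  have := (((hlim h0).sub (hlim hy)).add ((hside id fun _ => rfl).const_smul Complex.I)).sub
    ((hside (fun T => -T) abs_neg).const_smul Complex.I)
  have h := tendsto_nhds_unique this (tendsto_const_nhds.congr fun T => (key T).symm)
  simpa [sub_eq_zero] using h

/-- The line is moved to height `y = ∓β`, with sign opposite to `ξ`, where the kernel has modulus
`e^{-2πβ|ξ|}`. The bound with `A` and `c` only justifies the shift; the sharper majorant `b`
supplies the constant. -/
theorem norm_fourier_horizontal_le {f : ℂ → ℂ} {b : ℝ → ℝ} {β c A : ℝ} (hc : 0 < c) (hβ : 0 ≤ β)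
    (hd : DifferentiableOn ℂ f {z | |z.im| ≤ β})
    (hf : ∀ z : ℂ, |z.im| ≤ β → ‖f z‖ ≤ b z.re)
    (hb : ∀ x, b x ≤ A * Real.exp (-(c * |x|))) (hbi : Integrable b) (ξ : ℝ) :
    ‖FourierTransform.fourier (fun x : ℝ => f x) ξ‖ ≤
      Real.exp (-(2 * π * β * |ξ|)) * ∫ x, b x := by
  obtain ⟨y, hy, hyξ⟩ : ∃ y : ℝ, |y| ≤ β ∧ ξ * y = -(β * |ξ|) := by
    rcases le_total 0 ξ with h | h
    · exact ⟨-β, by simp [abs_of_nonneg hβ], by rw [abs_of_nonneg h]; ring⟩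
    · exact ⟨β, by simp [abs_of_nonneg hβ], by rw [abs_of_nonpos h]; ring⟩
  have hexp : ∀ z : ℂ, ‖Complex.exp (-2 * π * ξ * Complex.I * z)‖ =
      Real.exp (2 * π * (ξ * z.im)) := fun z => by
    rw [Complex.norm_exp]; congr 1; simp; ring
  have hbd : ∀ z : ℂ, |z.im| ≤ β → ‖Complex.exp (-2 * π * ξ * Complex.I * z) * f z‖ ≤
      Real.exp (2 * π * (|ξ| * β)) * A * Real.exp (-(c * |z.re|)) := by
    intro z hz
    rw [norm_mul, hexp, mul_assoc (Real.exp _)]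
    refine mul_le_mul (Real.exp_le_exp.2 ?_) ((hf z hz).trans (hb _)) (norm_nonneg _)
      (Real.exp_pos _).le
    refine mul_le_mul_of_nonneg_left ((le_abs_self _).trans ?_) (by positivity)
    rw [abs_mul]
    exact mul_le_mul_of_nonneg_left hz (abs_nonneg _)
  have hshift := integral_horizontal_eq (y := y) hc (β := β)
    (f := fun z => Complex.exp (-2 * π * ξ * Complex.I * z) * f z)
    (DifferentiableOn.mul (by fun_prop) hd) hbd hy
  have hF : FourierTransform.fourier (fun x : ℝ => f x) ξ =
      ∫ x : ℝ, Complex.exp (-2 * π * ξ * Complex.I * x) * f x := by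
    rw [Real.fourier_real_eq_integral_exp_smul]
    refine integral_congr_ae (ae_of_all _ fun x => ?_)
    simp only [smul_eq_mul]
    congr 2
    push_cast
    ring
  rw [hF, hshift, ← integral_const_mul]
  refine norm_integral_le_of_norm_le (hbi.const_mul _) (ae_of_all _ fun x => ?_)
  rw [norm_mul, hexp]
  have h1 : 2 * π * (ξ * (x + y * Complex.I : ℂ).im) = -(2 * π * β * |ξ|) := by
    simp [hyξ]; ring
  rw [h1]
  refine mul_le_mul_of_nonneg_left ?_ (Real.exp_pos _).le
  simpa using hf (x + y * Complex.I) (by simpa using hy)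

/-- The geometric series with ratio `exp (-r)`, without its leading term. -/
theorem hasSum_geometric_exp_succ {r : ℝ} (hr : 0 < r) (B : ℝ) :
    HasSum (fun n : ℕ => Real.exp (-(r * (n + 1))) * B) (B / (Real.exp r - 1)) := by
  have h1 : Real.exp (-r) < 1 := by simpa using hr
  have := ((hasSum_geometric_of_lt_one (Real.exp_pos (-r)).le h1).mul_left (Real.exp (-r))).mul_right B
  have he : Real.exp r - 1 ≠ 0 := by simpa [sub_eq_zero] using hr.ne'
  have hsum : Real.exp (-r) * (1 - Real.exp (-r))⁻¹ * B = B / (Real.exp r - 1) := by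
    have h2 : 1 - Real.exp (-r) ≠ 0 := by linarith
    rw [Real.exp_neg] at *
    field_simp
  rw [hsum] at this
  refine this.congr_fun fun n => ?_
  · rw [← Real.exp_nat_mul, ← Real.exp_add]
    congr 2; ring

theorem isBigO_cocompact_rpow_of_norm_le_exp {f : ℝ → ℂ} {c A : ℝ} (hc : 0 < c)
    (hf : ∀ x, ‖f x‖ ≤ A * Real.exp (-(c * |x|))) :
    f =O[cocompact ℝ] fun x : ℝ => |x| ^ (-2 : ℝ) := by
  have h1 : f =O[cocompact ℝ] fun x : ℝ => Real.exp (-c * |x|) :=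
    Asymptotics.IsBigO.of_bound A (Eventually.of_forall fun x => by simpa using hf x)
  exact h1.trans ((isLittleO_exp_neg_mul_rpow_atTop hc (-2)).isBigO.comp_tendsto
    tendsto_norm_cocompact_atTop)

/-- The trapezoidal rule with unit step for a function holomorphic in a strip. -/
theorem norm_integral_sub_tsum_int_le {f : ℂ → ℂ} {b : ℝ → ℝ} {β c A : ℝ} (hc : 0 < c) (hβ : 0 < β)
    (hd : DifferentiableOn ℂ f {z | |z.im| ≤ β})
    (hf : ∀ z : ℂ, |z.im| ≤ β → ‖f z‖ ≤ b z.re)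
    (hb : ∀ x, b x ≤ A * Real.exp (-(c * |x|))) (hbi : Integrable b) :
    ‖(∫ x : ℝ, f x) - ∑' k : ℤ, f (k : ℝ)‖ ≤
      2 * (∫ x, b x) / (Real.exp (2 * π * β) - 1) := by
  set B := ∫ x, b x
  set g : ℝ → ℂ := FourierTransform.fourier (fun x : ℝ => f x) with hg
  have hgb : ∀ ξ, ‖g ξ‖ ≤ Real.exp (-(2 * π * β * |ξ|)) * B :=
    norm_fourier_horizontal_le hc hβ.le hd hf hb hbi
  have hr : 0 < 2 * π * β := by positivity
  have hgeo := hasSum_geometric_exp_succ hr B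
  have hp : ∀ n : ℕ, ‖g ((n + 1 : ℤ) : ℝ)‖ ≤ Real.exp (-(2 * π * β * (n + 1))) * B := fun n => by
    refine (hgb _).trans_eq ?_
    rw [abs_of_nonneg (by positivity)]; push_cast; rfl
  have hm : ∀ n : ℕ, ‖g ((-(n + 1) : ℤ) : ℝ)‖ ≤ Real.exp (-(2 * π * β * (n + 1))) * B := fun n => by
    refine (hgb _).trans_eq ?_
    rw [Int.cast_neg, abs_neg, abs_of_nonneg (by positivity)]; push_cast; rfl
  have hsp : Summable fun n : ℕ => g ((n + 1 : ℤ) : ℝ) := .of_norm_bounded hgeo.summable hp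
  have hsm : Summable fun n : ℕ => g ((-(n + 1) : ℤ) : ℝ) := .of_norm_bounded hgeo.summable hm
  have hs := HasSum.of_add_one_of_neg_add_one (f := fun k : ℤ => g (k : ℝ)) hsp.hasSum hsm.hasSum
  have hcont : Continuous fun x : ℝ => f x := by
    simpa using continuous_comp_horizontal (y := 0) hd (by simpa using hβ.le)
  -- In Poisson's formula the zeroth frequency is the integral itself, so the error consists of the
  -- two geometric series over `k ≥ 1` and `k ≤ -1`.
  have hpoisson := Real.tsum_eq_tsum_fourier_of_rpow_decay_of_summable hcont one_lt_two
    (isBigO_cocompact_rpow_of_norm_le_exp (A := A) hc fun x => ?_) hs.summable 0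
  · have h0 : g 0 = ∫ x : ℝ, f x := by
      rw [hg, Real.fourier_real_eq_integral_exp_smul]; simp
    have hsum : ∑' k : ℤ, f (k : ℝ) = ∑' k : ℤ, g (k : ℝ) := by
      simpa using hpoisson
    rw [hsum, hs.tsum_eq, ← h0]
    have e : g 0 - ((∑' n : ℕ, g ((n + 1 : ℤ) : ℝ)) + g ((0 : ℤ) : ℝ) +
        ∑' n : ℕ, g ((-(n + 1) : ℤ) : ℝ)) =
        -((∑' n : ℕ, g ((n + 1 : ℤ) : ℝ)) + ∑' n : ℕ, g ((-(n + 1) : ℤ) : ℝ)) := by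
      rw [Int.cast_zero]; ring
    rw [e, norm_neg, mul_div_assoc, two_mul]
    exact (norm_add_le _ _).trans (add_le_add (tsum_of_norm_bounded hgeo hp)
      (tsum_of_norm_bounded hgeo hm))
  · simpa using (hf x (by simpa using hβ.le)).trans (hb _)

/-- The trapezoidal rule for a Banach space valued function holomorphic in a strip. -/
theorem norm_integral_sub_smul_tsum_le [CompleteSpace E] {f : ℂ → E} {b : ℝ → ℝ} {β A h : ℝ}
    (hβ : 0 < β) (hh : 0 < h)
    (hd : DifferentiableOn ℂ f {z | |z.im| ≤ β})
    (hf : ∀ z : ℂ, |z.im| ≤ β → ‖f z‖ ≤ b z.re)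
    (hb : ∀ x, b x ≤ A * Real.exp (-|x|)) (hbi : Integrable b)
    (hs : Summable fun k : ℤ => f ((k * h : ℝ) : ℂ)) :
    ‖(∫ x : ℝ, f x) - (h : ℂ) • ∑' k : ℤ, f ((k * h : ℝ) : ℂ)‖ ≤
      2 * (∫ x, b x) / (Real.exp (2 * π * β / h) - 1) := by
  -- A functional of norm at most `1` that attains the norm of the error reduces the claim to scalar
  -- functions.
  obtain ⟨φ, hφ, hφv⟩ := exists_dual_vector'' ℂ
    ((∫ x : ℝ, f x) - (h : ℂ) • ∑' k : ℤ, f ((k * h : ℝ) : ℂ))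
  have hint : Integrable fun x : ℝ => f x := by
    simpa using integrable_horizontal (y := 0) one_pos hd
      (fun z hz => by simpa using (hf z hz).trans (hb _)) (by simpa using hβ.le)
  have him : ∀ z : ℂ, ((h : ℂ) * z).im = h * z.im := fun z => by simp
  have hre : ∀ z : ℂ, ((h : ℂ) * z).re = h * z.re := fun z => by simp
  have hstrip : ∀ z : ℂ, |z.im| ≤ β / h → |((h : ℂ) * z).im| ≤ β := fun z hz => by
    rw [him, abs_mul, abs_of_pos hh, mul_comm]
    exact (le_div_iff₀ hh).1 hz
  -- Rescaling by `h` turns step `h` into step `1` and the half-width `β` into `β / h`.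
  have key := norm_integral_sub_tsum_int_le (f := fun z => (h : ℂ) * φ (f (h * z)))
    (b := fun x => h * b (h * x)) (β := β / h) (c := h) (A := h * A) hh (by positivity)
    ?_ ?_ ?_ ?_
  · have hB : ∫ x, h * b (h * x) = ∫ x, b x := by
      rw [integral_const_mul, Measure.integral_comp_mul_left, smul_eq_mul, abs_of_pos (by positivity),
        mul_inv_cancel_left₀ hh.ne']
    have hI : ∫ x : ℝ, (h : ℂ) * φ (f (h * (x : ℂ))) = φ (∫ x : ℝ, f x) := by
      rw [← φ.integral_comp_comm hint, integral_const_mul]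
      have := Measure.integral_comp_mul_left (fun x : ℝ => φ (f x)) h
      simp only [Complex.ofReal_mul] at this
      rw [this, abs_of_pos (by positivity), Complex.real_smul, ← mul_assoc, ← Complex.ofReal_mul,
        mul_inv_cancel₀ hh.ne', Complex.ofReal_one, one_mul]
    have hS : ∑' k : ℤ, (h : ℂ) * φ (f (h * ((k : ℝ) : ℂ))) =
        φ ((h : ℂ) • ∑' k : ℤ, f ((k * h : ℝ) : ℂ)) := by
      rw [map_smul, φ.map_tsum hs, smul_eq_mul, ← tsum_mul_left]
      refine tsum_congr fun k => ?_
      rw [mul_comm (k : ℝ) h, Complex.ofReal_mul]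
    rw [hB, hI, hS, ← map_sub, hφv, ← mul_div_assoc] at key
    simpa using key
  · refine DifferentiableOn.const_mul (φ.differentiable.comp_differentiableOn ?_) _
    exact hd.comp (by fun_prop) hstrip
  · intro z hz
    rw [norm_mul, Complex.norm_real, Real.norm_of_nonneg hh.le, ← hre]
    exact mul_le_mul_of_nonneg_left ((φ.le_of_opNorm_le hφ _).trans
      (by simpa using hf _ (hstrip z hz))) hh.le
  · intro x
    rw [mul_assoc]
    refine mul_le_mul_of_nonneg_left ((hb _).trans_eq ?_) hh.le
    rw [abs_mul, abs_of_pos hh]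
  · exact (hbi.comp_mul_left' hh.ne').const_mul h

end Strip

/-! ### Truncation of two-sided series. -/

section TwoSidedSums

theorem sum_Icc_neg_eq {E : Type*} [AddCommGroup E] (f : ℤ → E) (K : ℕ) :
    ∑ k ∈ Finset.Icc (-(K : ℤ)) K, f k =
      ∑ n ∈ Finset.range K, f (n + 1) + f 0 + ∑ n ∈ Finset.range K, f (-(n + 1)) := by
  induction K with
  | zero => simp
  | succ K ih =>
    have : Finset.Icc (-((K + 1 : ℕ) : ℤ)) ((K + 1 : ℕ) : ℤ) =
        insert ((K : ℤ) + 1) (insert (-((K : ℤ) + 1)) (Finset.Icc (-(K : ℤ)) K)) := by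
      ext x; simp only [Finset.mem_Icc, Finset.mem_insert]; omega
    rw [this, Finset.sum_insert, Finset.sum_insert, ih, Finset.sum_range_succ,
      Finset.sum_range_succ]
    · abel
    · simp only [Finset.mem_Icc]; omega
    · simp only [Finset.mem_insert, Finset.mem_Icc]; omega

variable {E : Type*} [NormedAddCommGroup E] [NormedSpace ℂ E] [CompleteSpace E]

/-- Each tail is a geometric series with sum `1 / (e^h - 1)` times `P` or `Q`, and the factor `h`
absorbs it because `h ≤ e^h - 1`. Hence the bound is free of `h`. -/
theorem summable_and_norm_smul_tsum_sub_sum_Icc_le {f : ℤ → E} {h P Q : ℝ} (K : ℕ) (hh : 0 < h)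
    (hP : 0 ≤ P) (hQ : 0 ≤ Q)
    (hp : ∀ n : ℕ, ‖f ((n + K : ℕ) + 1)‖ ≤ Real.exp (-(h * (n + 1))) * P)
    (hm : ∀ n : ℕ, ‖f (-((n + K : ℕ) + 1))‖ ≤ Real.exp (-(h * (n + 1))) * Q) :
    Summable f ∧
      ‖(h : ℂ) • ∑' k, f k - (h : ℂ) • ∑ k ∈ Finset.Icc (-(K : ℤ)) K, f k‖ ≤ P + Q := by
  have gP := hasSum_geometric_exp_succ hh P
  have gQ := hasSum_geometric_exp_succ hh Q
  have sp : Summable fun n : ℕ => f (n + 1) :=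
    (summable_nat_add_iff K).1 (.of_norm_bounded gP.summable hp)
  have sm : Summable fun n : ℕ => f (-(n + 1)) :=
    (summable_nat_add_iff K).1 (.of_norm_bounded gQ.summable hm)
  have hs := HasSum.of_add_one_of_neg_add_one sp.hasSum sm.hasSum
  refine ⟨hs.summable, ?_⟩
  rw [hs.tsum_eq, sum_Icc_neg_eq, ← smul_sub, ← sp.sum_add_tsum_nat_add K,
    ← sm.sum_add_tsum_nat_add K]
  have e : ∀ a b c d e : E, a + b + c + (d + e) - (a + c + d) = b + e := by intros; abel
  rw [e, norm_smul, Complex.norm_real, Real.norm_of_nonneg hh.le]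
  have hexp : h ≤ Real.exp h - 1 := by linarith [Real.add_one_le_exp h]
  calc h * ‖_‖ ≤ h * (P / (Real.exp h - 1) + Q / (Real.exp h - 1)) :=
        mul_le_mul_of_nonneg_left ((norm_add_le _ _).trans
          (add_le_add (tsum_of_norm_bounded gP hp) (tsum_of_norm_bounded gQ hm))) hh.le
    _ = h * (P + Q) / (Real.exp h - 1) := by ring
    _ ≤ P + Q := by
      rw [div_le_iff₀ (hh.trans_le hexp), mul_comm]
      exact mul_le_mul_of_nonneg_left hexp (add_nonneg hP hQ)

end TwoSidedSums

/-! ### Resolvent estimates and the explicit error bound. -/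

section Resolvent

variable {n : ℕ} {M : Matrix (Fin n) (Fin n) ℂ} {a γ β : ℝ}

theorem sub_smul_one_eq_neg (M : Matrix (Fin n) (Fin n) ℂ) (w : ℂ) :
    M - w • (1 : Matrix (Fin n) (Fin n) ℂ) = -(w • 1 - M) := by abel

theorem add_smul_one_eq_neg (M : Matrix (Fin n) (Fin n) ℂ) (w : ℂ) :
    M + w • (1 : Matrix (Fin n) (Fin n) ℂ) = -((-w) • 1 - M) := by rw [neg_smul]; abel

theorem inv_neg_eq_neg_inv {A : Matrix (Fin n) (Fin n) ℂ} (hA : IsUnit A) : (-A)⁻¹ = -A⁻¹ :=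
  Matrix.inv_eq_right_inv
    (by rw [neg_mul_neg, Matrix.mul_nonsing_inv A ((Matrix.isUnit_iff_isUnit_det _).1 hA)])

theorem isUnit_smul_one_sub_of_one_lt_norm (hM : ‖M‖ ≤ 1) {w : ℂ} (hw : 1 < ‖w‖) :
    IsUnit (w • (1 : Matrix (Fin n) (Fin n) ℂ) - M) := by
  have hw0 : w ≠ 0 := norm_pos_iff.1 (one_pos.trans hw)
  have h1 : ‖w⁻¹ • M‖ < 1 := by
    rw [norm_smul, norm_inv]
    exact mul_lt_one_of_nonneg_of_lt_one_left (by positivity) (inv_lt_one_of_one_lt₀ hw) hM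
  have h2 : w • (1 : Matrix (Fin n) (Fin n) ℂ) - M =
      algebraMap ℂ (Matrix (Fin n) (Fin n) ℂ) w * (1 - w⁻¹ • M) := by
    rw [← Algebra.smul_def, smul_sub, smul_inv_smul₀ hw0]
  rw [h2]
  exact ((IsUnit.mk0 w hw0).map _).mul (isUnit_one_sub_of_norm_lt_one h1)

/-- The sum `X` of the two inverses satisfies `(M² - w²) X = 2M`, so `w² X = M² X - 2M` and `‖w‖²
‖X‖ ≤ ‖X‖ + 2`. The cancellation gains a power of `‖w‖` over a single resolvent. -/
theorem norm_inv_sub_add_inv_add_le (hM : ‖M‖ ≤ 1) {w : ℂ} (hw : 1 < ‖w‖) :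
    ‖(M - w • (1 : Matrix (Fin n) (Fin n) ℂ))⁻¹ + (M + w • (1 : Matrix (Fin n) (Fin n) ℂ))⁻¹‖ ≤
      2 / (‖w‖ ^ 2 - 1) := by
  have hu : IsUnit (M - w • (1 : Matrix (Fin n) (Fin n) ℂ)) := by
    rw [sub_smul_one_eq_neg]; exact (isUnit_smul_one_sub_of_one_lt_norm hM hw).neg
  have hv : IsUnit (M + w • (1 : Matrix (Fin n) (Fin n) ℂ)) := by
    rw [add_smul_one_eq_neg]; exact (isUnit_smul_one_sub_of_one_lt_norm hM (by simpa)).neg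
  set U := M - w • (1 : Matrix (Fin n) (Fin n) ℂ) with hU
  set V := M + w • (1 : Matrix (Fin n) (Fin n) ℂ) with hV
  have hUi := Matrix.mul_nonsing_inv U ((Matrix.isUnit_iff_isUnit_det _).1 hu)
  have hVi := Matrix.mul_nonsing_inv V ((Matrix.isUnit_iff_isUnit_det _).1 hv)
  have hcomm : Commute M (w • 1) := (Commute.one_right M).smul_right w
  have hww : (w • 1 : Matrix (Fin n) (Fin n) ℂ) * (w • 1) = (w ^ 2) • 1 := by
    rw [smul_one_mul, smul_smul, sq]
  have hUV : U * V = M * M - (w ^ 2) • 1 := by rw [← hww, hcomm.mul_self_sub_mul_self_eq']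
  have hVU : V * U = M * M - (w ^ 2) • 1 := by rw [← hww, hcomm.mul_self_sub_mul_self_eq]
  have key : (M * M - (w ^ 2) • 1) * (U⁻¹ + V⁻¹) = (2 : ℂ) • M := by
    have h1 : (M * M - (w ^ 2) • 1) * U⁻¹ = V := by rw [← hVU, mul_assoc, hUi, mul_one]
    have h2 : (M * M - (w ^ 2) • 1) * V⁻¹ = U := by rw [← hUV, mul_assoc, hVi, mul_one]
    rw [mul_add, h1, h2, hU, hV, two_smul]
    abel
  set X := U⁻¹ + V⁻¹
  have key2 : (w ^ 2) • X = M * (M * X) - (2 : ℂ) • M := by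
    rw [← key, sub_mul, smul_mul_assoc, one_mul, mul_assoc]; abel
  have h3 : ‖w‖ ^ 2 * ‖X‖ ≤ ‖X‖ + 2 := by
    rw [← norm_pow, ← norm_smul, key2]
    refine (norm_sub_le _ _).trans (add_le_add ?_ ?_)
    · refine (norm_mul_le _ _).trans ((mul_le_of_le_one_left (norm_nonneg _) hM).trans ?_)
      exact (norm_mul_le _ _).trans (mul_le_of_le_one_left (norm_nonneg _) hM)
    · rw [norm_smul]; simpa using hM
  rw [le_div_iff₀ (by nlinarith)]
  linarith

theorem re_I_mul_exp (z : ℂ) : (Complex.I * Complex.exp z).re = -(Real.exp z.re * Real.sin z.im) := by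
  simp [Complex.exp_re, Complex.exp_im]

theorem norm_I_mul_exp (z : ℂ) : ‖Complex.I * Complex.exp z‖ = Real.exp z.re := by
  simp [Complex.norm_exp]

/-- If `Re z > 0`, the points `± i e^z` lie outside the closed unit disc, which contains the
spectrum; otherwise their real parts are at most `|sin (Im z)| ≤ a` in modulus. -/
theorem isUnit_sub_and_add (hM : ‖M‖ ≤ 1) (hres : StripResolventBound M a γ) {z : ℂ}
    (hz : |Real.sin z.im| ≤ a) :
    IsUnit (M - (Complex.I * Complex.exp z) • (1 : Matrix (Fin n) (Fin n) ℂ)) ∧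
      IsUnit (M + (Complex.I * Complex.exp z) • (1 : Matrix (Fin n) (Fin n) ℂ)) := by
  rw [sub_smul_one_eq_neg, add_smul_one_eq_neg, IsUnit.neg_iff, IsUnit.neg_iff]
  rcases lt_or_ge 0 z.re with h | h
  · have h1 : 1 < ‖Complex.I * Complex.exp z‖ := by rw [norm_I_mul_exp]; exact Real.one_lt_exp_iff.2 h
    exact ⟨isUnit_smul_one_sub_of_one_lt_norm hM h1,
      isUnit_smul_one_sub_of_one_lt_norm hM (by rwa [norm_neg])⟩
  · have h1 : |(Complex.I * Complex.exp z).re| ≤ a := by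
      rw [re_I_mul_exp, abs_neg, abs_mul, abs_of_pos (Real.exp_pos _)]
      exact (mul_le_of_le_one_left (abs_nonneg _) (Real.exp_le_one_iff.2 h)).trans hz
    exact ⟨(hres _ h1).1, (hres _ (by rwa [Complex.neg_re, abs_neg])).1⟩

theorem norm_logIntegrand (M : Matrix (Fin n) (Fin n) ℂ) (z : ℂ) :
    ‖logIntegrand M z‖ = π⁻¹ * Real.exp z.re *
      ‖(M - (Complex.I * Complex.exp z) • (1 : Matrix (Fin n) (Fin n) ℂ))⁻¹ +
        (M + (Complex.I * Complex.exp z) • (1 : Matrix (Fin n) (Fin n) ℂ))⁻¹‖ := by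
  rw [logIntegrand, norm_smul, norm_mul, Complex.norm_exp, norm_inv, Complex.norm_real,
    Real.norm_of_nonneg pi_pos.le]

theorem norm_logIntegrand_le_of_exp_mul_sin_le (hres : StripResolventBound M a γ) {z : ℂ}
    (hz : Real.exp z.re * |Real.sin z.im| ≤ a) :
    ‖logIntegrand M z‖ ≤ 2 * γ / π * Real.exp z.re := by
  have h1 : |(Complex.I * Complex.exp z).re| ≤ a := by
    rwa [re_I_mul_exp, abs_neg, abs_mul, abs_of_pos (Real.exp_pos _)]
  have h1' : |(-(Complex.I * Complex.exp z)).re| ≤ a := by rwa [Complex.neg_re, abs_neg]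
  rw [norm_logIntegrand, sub_smul_one_eq_neg, add_smul_one_eq_neg,
    inv_neg_eq_neg_inv (hres _ h1).1, inv_neg_eq_neg_inv (hres _ h1').1]
  have h2 := norm_add_le_of_le ((norm_neg _).trans_le (hres _ h1).2)
    ((norm_neg _).trans_le (hres _ h1').2)
  refine (mul_le_mul_of_nonneg_left h2 (by positivity)).trans_eq ?_
  ring

theorem norm_logIntegrand_le_of_re_pos (hM : ‖M‖ ≤ 1) {z : ℂ} (hz : 0 < z.re) :
    ‖logIntegrand M z‖ ≤ 2 / π * (Real.exp z.re / (Real.exp z.re ^ 2 - 1)) := by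
  have h := norm_inv_sub_add_inv_add_le hM
    (w := Complex.I * Complex.exp z) (by rw [norm_I_mul_exp]; exact Real.one_lt_exp_iff.2 hz)
  rw [norm_I_mul_exp] at h
  rw [norm_logIntegrand]
  refine (mul_le_mul_of_nonneg_left h (by positivity)).trans_eq ?_
  ring

theorem norm_logIntegrand_le_exp_neg (hM : ‖M‖ ≤ 1) {z : ℂ} {X : ℝ} (hX : 0 < X)
    (hz : X ≤ z.re) :
    ‖logIntegrand M z‖ ≤ 2 / π / (1 - Real.exp (-X)) * Real.exp (-z.re) := by
  refine (norm_logIntegrand_le_of_re_pos hM (hX.trans_le hz)).trans ?_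
  have h1 : Real.exp (-X) < 1 := by simpa using hX
  have h2 : Real.exp (-z.re) ≤ Real.exp (-X) := by simpa using hz
  have h3 : Real.exp z.re / (Real.exp z.re ^ 2 - 1) =
      Real.exp (-z.re) / (1 - Real.exp (-z.re) ^ 2) := by
    have := Real.one_lt_exp_iff.2 (hX.trans_le hz)
    have h4 : Real.exp z.re ^ 2 - 1 ≠ 0 := by nlinarith
    rw [Real.exp_neg]
    field_simp
  -- Replacing `e^{-2x}` by the larger `e^{-X}` is what produces the denominators `a - sin β` and
  -- `e^{Kh} - 1` later.
  have h5 : 1 - Real.exp (-X) ≤ 1 - Real.exp (-z.re) ^ 2 := by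
    nlinarith [Real.exp_pos (-z.re)]
  rw [h3, div_mul_eq_mul_div (2 / π), ← mul_div_assoc]
  exact div_le_div_of_nonneg_left (by positivity) (by linarith) h5

theorem differentiableAt_logIntegrand (hM : ‖M‖ ≤ 1) (hres : StripResolventBound M a γ) {z : ℂ}
    (hz : |Real.sin z.im| ≤ a) : DifferentiableAt ℂ (logIntegrand M) z := by
  obtain ⟨h1, h2⟩ := isUnit_sub_and_add hM hres hz
  unfold logIntegrand
  simp only [Matrix.nonsing_inv_eq_ringInverse]
  refine DifferentiableAt.fun_smul (by fun_prop) (DifferentiableAt.fun_add ?_ ?_)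
  · exact DifferentiableAt.comp
      (f := fun w => M - (Complex.I * Complex.exp w) • (1 : Matrix (Fin n) (Fin n) ℂ)) z
      (differentiableAt_inverse h1) (by fun_prop)
  · exact DifferentiableAt.comp
      (f := fun w => M + (Complex.I * Complex.exp w) • (1 : Matrix (Fin n) (Fin n) ℂ)) z
      (differentiableAt_inverse h2) (by fun_prop)

theorem abs_sin_le_sin {y : ℝ} (hβ : β ≤ π / 2) (hy : |y| ≤ β) : |Real.sin y| ≤ Real.sin β := by
  obtain ⟨h1, h2⟩ := abs_le.1 hy
  rw [abs_le, ← Real.sin_neg]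
  exact ⟨Real.sin_le_sin_of_le_of_le_pi_div_two (by linarith) (by linarith) h1,
    Real.sin_le_sin_of_le_of_le_pi_div_two (by linarith) hβ h2⟩

theorem sin_lt_of_lt_arcsin (hβ0 : 0 < β) (hβ : β < Real.arcsin a) : Real.sin β < a :=
  (Real.lt_arcsin_iff_sin_lt' ⟨by linarith [pi_pos],
    hβ.trans_le (Real.arcsin_le_pi_div_two a)⟩).1 hβ

theorem sin_pos_of_lt_arcsin (hβ0 : 0 < β) (hβ : β < Real.arcsin a) : 0 < Real.sin β :=
  Real.sin_pos_of_pos_of_lt_pi hβ0 (by linarith [Real.arcsin_le_pi_div_two a, pi_pos])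

theorem abs_sin_le_of_abs_le (hβ : β < Real.arcsin a) {y : ℝ} (hy : |y| ≤ β) :
    |Real.sin y| ≤ Real.sin β :=
  abs_sin_le_sin (hβ.le.trans (Real.arcsin_le_pi_div_two a)) hy

theorem differentiableOn_logIntegrand (hM : ‖M‖ ≤ 1) (hres : StripResolventBound M a γ)
    (hβ0 : 0 < β) (hβ : β < Real.arcsin a) :
    DifferentiableOn ℂ (logIntegrand M) {z | |z.im| ≤ β} := fun _ hz =>
  (differentiableAt_logIntegrand hM hres ((abs_sin_le_of_abs_le hβ hz).trans
    (sin_lt_of_lt_arcsin hβ0 hβ).le)).differentiableWithinAt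

theorem nonneg_of_stripResolventBound (ha : 0 < a) (hres : StripResolventBound M a γ) : 0 ≤ γ :=
  (norm_nonneg _).trans (hres 0 (by simpa using ha.le)).2

/-- An integrable bound for `‖F_M(x + iy)‖`, uniform in `|y| ≤ β`. -/
noncomputable def stripMajorant (β a γ x : ℝ) : ℝ :=
  if x ≤ Real.log (a / Real.sin β) then 2 * γ / π * Real.exp x
  else 2 / π / (1 - Real.sin β / a) * Real.exp (-x)

theorem exp_log_div_sin (hβ0 : 0 < β) (hβ : β < Real.arcsin a) : Real.exp (Real.log (a / Real.sin β)) = a / Real.sin β :=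
  Real.exp_log (div_pos ((sin_pos_of_lt_arcsin hβ0 hβ).trans (sin_lt_of_lt_arcsin hβ0 hβ))
    (sin_pos_of_lt_arcsin hβ0 hβ))

theorem log_div_sin_pos (hβ0 : 0 < β) (hβ : β < Real.arcsin a) : 0 < Real.log (a / Real.sin β) :=
  Real.log_pos ((one_lt_div (sin_pos_of_lt_arcsin hβ0 hβ)).2 (sin_lt_of_lt_arcsin hβ0 hβ))

/-- The threshold `log (a / sin β)` is where `e^x sin β = a`: up to it `± i e^z` stays in the
resolvent strip for every `|Im z| ≤ β`. It is positive, so the decay estimate applies beyond it. -/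
theorem norm_logIntegrand_le_stripMajorant (hβ0 : 0 < β) (hβ : β < Real.arcsin a) (hM : ‖M‖ ≤ 1) (hres : StripResolventBound M a γ)
    {z : ℂ} (hz : |z.im| ≤ β) : ‖logIntegrand M z‖ ≤ stripMajorant β a γ z.re := by
  have hs := sin_pos_of_lt_arcsin hβ0 hβ
  unfold stripMajorant
  split_ifs with h
  · refine norm_logIntegrand_le_of_exp_mul_sin_le hres ?_
    have h1 := Real.exp_le_exp.2 h
    rw [exp_log_div_sin hβ0 hβ] at h1
    exact (mul_le_mul h1 (abs_sin_le_of_abs_le hβ hz) (abs_nonneg _)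
      ((Real.exp_pos _).le.trans h1)).trans_eq (div_mul_cancel₀ _ hs.ne')
  · have := norm_logIntegrand_le_exp_neg hM (log_div_sin_pos hβ0 hβ) (not_le.1 h).le
    rwa [Real.exp_neg (Real.log _), exp_log_div_sin hβ0 hβ, inv_div] at this

theorem stripMajorant_le (hβ0 : 0 < β) (hβ : β < Real.arcsin a) (hγ : 0 ≤ γ) (x : ℝ) :
    stripMajorant β a γ x ≤ (2 * γ / π * Real.exp (2 * Real.log (a / Real.sin β)) +
      2 / π / (1 - Real.sin β / a)) * Real.exp (-|x|) := by
  have hs := sin_pos_of_lt_arcsin hβ0 hβ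
  have hsa := sin_lt_of_lt_arcsin hβ0 hβ
  have hX := log_div_sin_pos hβ0 hβ
  have h1 : 0 < 1 - Real.sin β / a := sub_pos.2 ((div_lt_one (hs.trans hsa)).2 hsa)
  unfold stripMajorant
  rw [add_mul]
  split_ifs with h
  · refine le_add_of_le_of_nonneg ?_ (by positivity)
    rw [mul_assoc, ← Real.exp_add]
    -- The factor `e^{2X}` with `X = log (a / sin β)` suffices because `x + |x| ≤ 2X` for `x ≤ X`.
    refine mul_le_mul_of_nonneg_left (Real.exp_le_exp.2 ?_) (by positivity)
    rcases abs_cases x with ⟨h2, -⟩ | ⟨h2, -⟩ <;> rw [h2] <;> linarith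
  · rw [abs_of_pos (hX.trans (not_le.1 h))]
    exact le_add_of_nonneg_left (by positivity)

theorem integrable_stripMajorant (hβ0 : 0 < β) (hβ : β < Real.arcsin a) : Integrable (stripMajorant β a γ) ∧
    2 * ∫ x, stripMajorant β a γ x = stripConst β a γ := by
  have hs := sin_pos_of_lt_arcsin hβ0 hβ
  have hsa := sin_lt_of_lt_arcsin hβ0 hβ
  set X := Real.log (a / Real.sin β) with hX
  have e1 : EqOn (fun x => 2 * γ / π * Real.exp x) (stripMajorant β a γ) (Iic X) :=
    fun x hx => (if_pos hx).symm
  have e2 : EqOn (fun x => 2 / π / (1 - Real.sin β / a) * Real.exp (-x)) (stripMajorant β a γ)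
      (Ioi X) := fun x hx => (if_neg (not_le.2 hx)).symm
  have i1 : IntegrableOn (stripMajorant β a γ) (Iic X) :=
    IntegrableOn.congr_fun ((integrableOn_exp_Iic X).const_mul _) e1 measurableSet_Iic
  have i2 : IntegrableOn (stripMajorant β a γ) (Ioi X) := by
    refine IntegrableOn.congr_fun (Integrable.const_mul ?_ _) e2 measurableSet_Ioi
    simpa [IntegrableOn] using exp_neg_integrableOn_Ioi X one_pos
  refine ⟨by simpa [← integrableOn_univ] using i1.union i2, ?_⟩
  rw [← intervalIntegral.integral_Iic_add_Ioi i1 i2, ← setIntegral_congr_fun measurableSet_Iic e1,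
    ← setIntegral_congr_fun measurableSet_Ioi e2, integral_const_mul, integral_const_mul,
    integral_exp_Iic, integral_exp_neg_Ioi, Real.exp_neg, exp_log_div_sin hβ0 hβ, stripConst]
  have h1 : a - Real.sin β ≠ 0 := (sub_pos.2 hsa).ne'
  have h2 : a ≠ 0 := (hs.trans hsa).ne'
  field_simp
  ring

theorem integrable_logIntegrand (hβ0 : 0 < β) (hβ : β < Real.arcsin a) (hM : ‖M‖ ≤ 1) (hres : StripResolventBound M a γ) :
    Integrable fun x : ℝ => logIntegrand M x := by
  have hγ := nonneg_of_stripResolventBound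
    ((sin_pos_of_lt_arcsin hβ0 hβ).trans (sin_lt_of_lt_arcsin hβ0 hβ)) hres
  simpa using integrable_horizontal (y := 0) one_pos (differentiableOn_logIntegrand hM hres hβ0 hβ)
    (fun z hz => (norm_logIntegrand_le_stripMajorant hβ0 hβ hM hres hz).trans
      (by simpa using stripMajorant_le hβ0 hβ hγ z.re)) (by simpa using hβ0.le)

theorem logSincSum_eq_smul_sum (K : ℕ) (h : ℝ) : logSincSum K h M =
    (h : ℂ) • ∑ k ∈ Finset.Icc (-(K : ℤ)) K, logIntegrand M ((k * h : ℝ) : ℂ) := by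
  rw [logSincSum, Finset.smul_sum, Finset.smul_sum]
  refine Finset.sum_congr rfl fun k _ => ?_
  simp only [logIntegrand, node, Complex.ofReal_exp, smul_smul, div_eq_mul_inv, Complex.ofReal_mul,
    Complex.ofReal_inv, mul_assoc]

theorem norm_integral_sub_logSincSum_le (hβ0 : 0 < β) (hβ : β < Real.arcsin a) (hM : ‖M‖ ≤ 1) (hres : StripResolventBound M a γ)
    {h : ℝ} {K : ℕ} (hh : 0 < h) (hK : 1 ≤ K) :
    ‖(∫ x : ℝ, logIntegrand M x) - logSincSum K h M‖ ≤ sincError K h β a γ := by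
  have hγ := nonneg_of_stripResolventBound
    ((sin_pos_of_lt_arcsin hβ0 hβ).trans (sin_lt_of_lt_arcsin hβ0 hβ)) hres
  have hKh : 0 < K * h := mul_pos (by exact_mod_cast hK) hh
  have he : 1 < Real.exp (K * h) := Real.one_lt_exp_iff.2 hKh
  have he' : 0 < Real.exp (K * h) - 1 := sub_pos.2 he
  have hp : ∀ m : ℕ, ‖logIntegrand M ((((m + K : ℕ) + 1 : ℤ) * h : ℝ) : ℂ)‖ ≤
      Real.exp (-(h * (m + 1))) * (2 / (π * (Real.exp (K * h) - 1))) := fun m => by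
    refine (norm_logIntegrand_le_exp_neg hM hKh ?_).trans_eq ?_
    · rw [Complex.ofReal_re]
      refine mul_le_mul_of_nonneg_right ?_ hh.le
      push_cast; linarith [(m.cast_nonneg : (0 : ℝ) ≤ m)]
    · have h1 : -(((m + K : ℕ) + 1 : ℤ) * h : ℝ) = -(h * (m + 1)) + -(K * h) := by push_cast; ring
      rw [Complex.ofReal_re, h1, Real.exp_add, Real.exp_neg (K * h)]
      have : Real.exp (K * h) ≠ 0 := (Real.exp_pos _).ne'
      field_simp
  have hm : ∀ m : ℕ, ‖logIntegrand M (((-((m + K : ℕ) + 1) : ℤ) * h : ℝ) : ℂ)‖ ≤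
      Real.exp (-(h * (m + 1))) * (2 * γ / π * Real.exp (-(K * h))) := fun m => by
    refine (norm_logIntegrand_le_of_exp_mul_sin_le hres ?_).trans_eq ?_
    -- On the real axis `± i e^x` is purely imaginary, so the `γ` bound holds at every node.
    · simpa using ((sin_pos_of_lt_arcsin hβ0 hβ).trans (sin_lt_of_lt_arcsin hβ0 hβ)).le
    · have h1 : ((-((m + K : ℕ) + 1) : ℤ) * h : ℝ) = -(h * (m + 1)) + -(K * h) := by push_cast; ring
      rw [Complex.ofReal_re, h1, Real.exp_add]
      ring
  obtain ⟨hs, htail⟩ := summable_and_norm_smul_tsum_sub_sum_Icc_le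
    (f := fun k : ℤ => logIntegrand M ((k * h : ℝ) : ℂ)) K hh (by positivity) (by positivity) hp hm
  have hstrip := norm_integral_sub_smul_tsum_le hβ0 hh (differentiableOn_logIntegrand hM hres hβ0 hβ)
    (fun z hz => norm_logIntegrand_le_stripMajorant hβ0 hβ hM hres hz)
    (stripMajorant_le hβ0 hβ hγ) (integrable_stripMajorant hβ0 hβ).1 hs
  rw [(integrable_stripMajorant hβ0 hβ).2] at hstrip
  rw [logSincSum_eq_smul_sum, sincError]
  refine (norm_sub_le_norm_sub_add_norm_sub _ _ _).trans ((add_le_add hstrip htail).trans_eq ?_)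
  ring

end Resolvent

/-! ### The sign as an integral: scalar polar terms. -/

section SignFormula

variable {E : Type*} [NormedAddCommGroup E] [NormedSpace ℂ E]

/-- `L` is the cycle integral of `halfPlaneSign • G` around small circles centred at the points of
`s`, and also the total increment of a primitive of the logarithmic line integrand of `G`. -/
def SignFormula (s : Finset ℂ) (G : ℂ → E) (L : E) : Prop :=
  (∃ Φ : ℝ → E,
    (∀ x : ℝ, HasDerivAt Φ (-(((π : ℂ)⁻¹ * Complex.exp x) •
      (G (Complex.I * Complex.exp x) + G (-(Complex.I * Complex.exp x))))) x) ∧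
    Tendsto Φ atBot (𝓝 0) ∧ Tendsto Φ atTop (𝓝 L)) ∧
  ∀ᶠ r in 𝓝[>] (0 : ℝ), (∀ μ ∈ s, CircleIntegrable (fun z => halfPlaneSign z • G z) μ r) ∧
    (2 * (π : ℂ) * Complex.I)⁻¹ • ∑ μ ∈ s, ∮ z in C(μ, r), halfPlaneSign z • G z = L

theorem SignFormula.zero (s : Finset ℂ) : SignFormula s (0 : ℂ → E) 0 := by
  refine ⟨⟨fun _ => 0, fun x => ?_, tendsto_const_nhds, tendsto_const_nhds⟩, .of_forall fun r => ?_⟩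
  · simpa using hasDerivAt_const x (0 : E)
  · simp [CircleIntegrable, circleIntegral]

theorem SignFormula.add {s : Finset ℂ} {G H : ℂ → E} {L L' : E} (hG : SignFormula s G L)
    (hH : SignFormula s H L') : SignFormula s (G + H) (L + L') := by
  obtain ⟨⟨Φ, hd, hb, ht⟩, hc⟩ := hG
  obtain ⟨⟨Ψ, hd', hb', ht'⟩, hc'⟩ := hH
  refine ⟨⟨fun x => Φ x + Ψ x, fun x => ?_, by simpa using hb.add hb', ht.add ht'⟩, ?_⟩
  · convert (hd x).fun_add (hd' x) using 1
    simp only [Pi.add_apply, smul_add, neg_add]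
    abel
  · filter_upwards [hc, hc'] with r ⟨h1, h2⟩ ⟨h3, h4⟩
    have e : (fun z => halfPlaneSign z • (G + H) z) =
        (fun z => halfPlaneSign z • G z) + fun z => halfPlaneSign z • H z := by
      ext z; simp
    refine ⟨fun μ hμ => e ▸ (h1 μ hμ).add (h3 μ hμ), ?_⟩
    rw [← h2, ← h4, ← smul_add, ← Finset.sum_add_distrib]
    congr 1
    refine Finset.sum_congr rfl fun μ hμ => ?_
    rw [← circleIntegral.integral_add (h1 μ hμ) (h3 μ hμ), e]
    rfl

theorem SignFormula.smul_const [CompleteSpace E] {s : Finset ℂ} {g : ℂ → ℂ} {l : ℂ}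
    (hg : SignFormula s g l) (A : E) : SignFormula s (fun z => g z • A) (l • A) := by
  obtain ⟨⟨Φ, hd, hb, ht⟩, hc⟩ := hg
  refine ⟨⟨fun x => Φ x • A, fun x => ?_, by simpa using hb.smul_const A, ht.smul_const A⟩, ?_⟩
  · convert (hd x).smul_const A using 1
    simp only [smul_add, smul_eq_mul, neg_smul, add_smul, smul_smul, mul_add]
  · filter_upwards [hc] with r ⟨h1, h2⟩
    have e : ∀ z, halfPlaneSign z • g z • A = (halfPlaneSign z • g z) • A := fun z => by
      rw [smul_assoc]
    simp only [e]
    refine ⟨fun μ hμ => (h1 μ hμ).smul_continuousOn continuousOn_const, ?_⟩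
    simp only [circleIntegral.integral_smul_const]
    rw [← Finset.sum_smul, ← smul_assoc, h2]

theorem halfPlaneSign_eq_of_norm_sub_lt {z μ : ℂ} (h : ‖z - μ‖ < |μ.re|) :
    halfPlaneSign z = halfPlaneSign μ := by
  have h1 : |z.re - μ.re| < |μ.re| := by
    simpa using (Complex.abs_re_le_norm (z - μ)).trans_lt h
  have h2 := abs_lt.1 h1
  unfold halfPlaneSign
  rcases lt_trichotomy μ.re 0 with h3 | h3 | h3
  · rw [abs_of_neg h3] at h2
    rw [if_neg (by linarith), if_pos (by linarith), if_neg (by linarith), if_pos h3]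
  · simp [h3] at h1
    exact absurd h1 (not_lt.2 (abs_nonneg _))
  · rw [abs_of_pos h3] at h2
    rw [if_pos (by linarith), if_pos h3]

/-- For such radii the circles miss the imaginary axis, so `halfPlaneSign` is constant on each, and
each closed disc contains only its own centre from `s`. -/
theorem eventually_small_radius (s : Finset ℂ) (hs : ∀ μ ∈ s, μ.re ≠ 0) :
    ∀ᶠ r in 𝓝[>] (0 : ℝ), 0 < r ∧
      ∀ μ ∈ s, r < |μ.re| ∧ ∀ ν ∈ s, ν ≠ μ → r < ‖ν - μ‖ := by
  have hlt : ∀ {d : ℝ}, 0 < d → ∀ᶠ r in 𝓝[>] (0 : ℝ), r < d := fun hd =>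
    eventually_nhdsWithin_of_eventually_nhds (eventually_lt_nhds hd)
  refine eventually_mem_nhdsWithin.and ((eventually_all_finset s).2 fun μ hμ =>
    (hlt (abs_pos.2 (hs μ hμ))).and ((eventually_all_finset s).2 fun ν _ => ?_))
  by_cases h : ν = μ
  · simp [h]
  · simpa [h] using hlt (norm_pos_iff.2 (sub_ne_zero.2 h))

theorem notMem_of_mem_sphere {s : Finset ℂ} {r : ℝ} (hr0 : 0 < r)
    {μ z : ℂ} (hr : ∀ ν ∈ s, ν ≠ μ → r < ‖ν - μ‖) (hz : z ∈ Metric.sphere μ r) : z ∉ s := by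
  intro hzs
  rw [mem_sphere_iff_norm] at hz
  have hne : z ≠ μ := by
    rintro rfl
    simp at hz
    exact hr0.ne hz
  exact (hr z hzs hne).ne' hz

/-- Cycle integral of a scalar function `g` that is regular off one point `ν` of `s`. -/
theorem eventually_cycle_eq {s : Finset ℂ} (hs : ∀ μ ∈ s, μ.re ≠ 0) {ν : ℂ} (hν : ν ∈ s) {g : ℂ → ℂ}
    {c : ℂ} (hg : DifferentiableOn ℂ g {ν}ᶜ) (hc : ∀ r > 0, ∮ z in C(ν, r), g z = c) :
    ∀ᶠ r in 𝓝[>] (0 : ℝ), (∀ μ ∈ s, CircleIntegrable (fun z => halfPlaneSign z • g z) μ r) ∧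
      ∑ μ ∈ s, ∮ z in C(μ, r), halfPlaneSign z • g z = halfPlaneSign ν * c := by
  filter_upwards [eventually_small_radius s hs] with r ⟨hr0, hr⟩
  have hsph : ∀ μ ∈ s, EqOn (fun z => halfPlaneSign z • g z) (fun z => halfPlaneSign μ * g z)
      (Metric.sphere μ r) := fun μ hμ z hz => by
    simp only [smul_eq_mul]
    rw [halfPlaneSign_eq_of_norm_sub_lt (by rw [mem_sphere_iff_norm.1 hz]; exact (hr μ hμ).1)]
  have hint : ∀ μ ∈ s, ∮ z in C(μ, r), halfPlaneSign z • g z =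
      halfPlaneSign μ * ∮ z in C(μ, r), g z := fun μ hμ => by
    rw [circleIntegral.integral_congr hr0.le (hsph μ hμ), circleIntegral.integral_const_mul]
  refine ⟨fun μ hμ => ContinuousOn.circleIntegrable hr0.le
    (ContinuousOn.congr (continuousOn_const.mul (hg.continuousOn.mono fun z hz => ?_))
      (hsph μ hμ)), ?_⟩
  · rintro rfl
    exact notMem_of_mem_sphere hr0 (hr μ hμ).2 hz hν
  · rw [Finset.sum_congr rfl hint, Finset.sum_eq_single_of_mem ν hν, hc r hr0]
    intro μ hμ hμν
    have hball : Metric.closedBall μ r ⊆ {ν}ᶜ := by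
      rintro z hz rfl
      exact absurd ((hr μ hμ).2 z hν hμν.symm) (not_lt.2 (mem_closedBall_iff_norm.1 hz))
    rw [Complex.circleIntegral_eq_zero_of_differentiable_on_off_countable hr0.le countable_empty
      (hg.continuousOn.mono hball) fun z hz => ?_, mul_zero]
    exact (hg z (hball (Metric.ball_subset_closedBall hz.1))).differentiableAt
      (isOpen_compl_singleton.mem_nhds (hball (Metric.ball_subset_closedBall hz.1)))

section Primitives

variable {ν : ℂ}

theorem hasDerivAt_I_mul_exp (ν : ℂ) (x : ℝ) :
    HasDerivAt (fun x : ℝ => Complex.I * Complex.exp x - ν) (Complex.I * Complex.exp x) x :=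
  (((Complex.hasDerivAt_exp _).const_mul Complex.I).sub_const ν).comp_ofReal

theorem hasDerivAt_neg_I_mul_exp (ν : ℂ) (x : ℝ) :
    HasDerivAt (fun x : ℝ => -(Complex.I * Complex.exp x) - ν) (-(Complex.I * Complex.exp x)) x :=
  (((Complex.hasDerivAt_exp _).const_mul Complex.I).neg.sub_const ν).comp_ofReal

theorem I_mul_exp_sub_ne_zero (hν : ν.re ≠ 0) (x : ℝ) : Complex.I * Complex.exp x - ν ≠ 0 := by
  intro h
  apply hν
  have := congrArg Complex.re h
  simpa [Complex.exp_im] using this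

theorem neg_I_mul_exp_sub_ne_zero (hν : ν.re ≠ 0) (x : ℝ) :
    -(Complex.I * Complex.exp x) - ν ≠ 0 := by
  intro h
  apply hν
  have := congrArg Complex.re h
  simpa [Complex.exp_im] using this

theorem tendsto_ofReal_exp_atBot : Tendsto (fun x : ℝ => Complex.exp x) atBot (𝓝 0) := by
  have := (Complex.continuous_ofReal.tendsto 0).comp Real.tendsto_exp_atBot
  simpa [Function.comp_def] using this

theorem tendsto_I_mul_exp_sub_cobounded (ν : ℂ) {u : ℂ} (hu : ‖u‖ = 1) :
    Tendsto (fun x : ℝ => u * Complex.exp x - ν) atTop (Bornology.cobounded ℂ) := by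
  rw [← tendsto_norm_atTop_iff_cobounded]
  refine tendsto_atTop_mono (fun x => ?_) (tendsto_atTop_add_const_right _ (-‖ν‖) Real.tendsto_exp_atTop)
  have := norm_sub_norm_le (u * Complex.exp x) ν
  rw [norm_mul, hu, one_mul, Complex.norm_exp, Complex.ofReal_re] at this
  linarith

/-- The primitive is a multiple of a difference of `j`-th inverse powers: at `-∞` both tend to
`(-ν)⁻¹ ^ j` and cancel, at `+∞` both vanish. -/
theorem primitive_inv_pow (hν : ν.re ≠ 0) {j : ℕ} (hj : j ≠ 0) :
    ∃ Φ : ℝ → ℂ,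
      (∀ x : ℝ, HasDerivAt Φ (-(((π : ℂ)⁻¹ * Complex.exp x) •
        ((Complex.I * Complex.exp x - ν)⁻¹ ^ (j + 1) +
          (-(Complex.I * Complex.exp x) - ν)⁻¹ ^ (j + 1)))) x) ∧
      Tendsto Φ atBot (𝓝 0) ∧ Tendsto Φ atTop (𝓝 0) := by
  refine ⟨fun x => -((π : ℂ)⁻¹ * (Complex.I / j)) * ((Complex.I * Complex.exp x - ν)⁻¹ ^ j -
    (-(Complex.I * Complex.exp x) - ν)⁻¹ ^ j), fun x => ?_, ?_, ?_⟩
  · have h1 := I_mul_exp_sub_ne_zero hν x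
    have h2 := neg_I_mul_exp_sub_ne_zero hν x
    have hp : ∀ {w : ℝ → ℂ} {w' : ℂ}, HasDerivAt w w' x → w x ≠ 0 →
        HasDerivAt (fun y => (w y)⁻¹ ^ j) (-(j * w' * (w x)⁻¹ ^ (j + 1))) x := fun {w w'} hw h0 => by
      refine ((hasDerivAt_pow j _).comp x (hw.fun_inv h0)).congr_deriv ?_
      obtain ⟨k, rfl⟩ := Nat.exists_eq_succ_of_ne_zero hj
      simp only [Nat.succ_eq_add_one, Nat.add_sub_cancel, div_eq_mul_inv, ← inv_pow]
      ring
    refine (((hp (hasDerivAt_I_mul_exp ν x) h1).fun_sub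
      (hp (hasDerivAt_neg_I_mul_exp ν x) h2)).const_mul _).congr_deriv ?_
    have hj' : (j : ℂ) ≠ 0 := by exact_mod_cast hj
    simp only [smul_eq_mul]
    generalize (Complex.I * Complex.exp x - ν)⁻¹ ^ (j + 1) = p
    generalize (-(Complex.I * Complex.exp x) - ν)⁻¹ ^ (j + 1) = q
    have hI := Complex.I_mul_I
    field_simp
    linear_combination (p + q) * hI
  · have hν0 : ν ≠ 0 := by rintro rfl; simp at hν
    have h1 : Tendsto (fun x : ℝ => Complex.I * Complex.exp x) atBot (𝓝 0) := by
      simpa using tendsto_ofReal_exp_atBot.const_mul Complex.I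
    have h2 := ((h1.sub_const ν).inv₀ (by simpa)).pow j
    have h3 := ((h1.neg.sub_const ν).inv₀ (by simpa)).pow j
    simpa using (h2.sub h3).const_mul (-((π : ℂ)⁻¹ * (Complex.I / j)))
  · have h1 := (tendsto_inv₀_cobounded.comp
      (tendsto_I_mul_exp_sub_cobounded ν (u := Complex.I) (by simp))).pow j
    have h2 := (tendsto_inv₀_cobounded.comp
      (tendsto_I_mul_exp_sub_cobounded ν (u := -Complex.I) (by simp))).pow j
    simpa [hj] using (h1.sub h2).const_mul (-((π : ℂ)⁻¹ * (Complex.I / j)))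

/-- For `Re ν < 0` the points `± i e^x - ν` stay in the right half-plane, where the principal
logarithm is a primitive. The limit is `(i/π)(log i - log (-i)) = -1`. -/
theorem primitive_inv_of_re_neg (hν : ν.re < 0) :
    ∃ Φ : ℝ → ℂ,
      (∀ x : ℝ, HasDerivAt Φ (-(((π : ℂ)⁻¹ * Complex.exp x) •
        ((Complex.I * Complex.exp x - ν)⁻¹ + (-(Complex.I * Complex.exp x) - ν)⁻¹))) x) ∧
      Tendsto Φ atBot (𝓝 0) ∧ Tendsto Φ atTop (𝓝 (-1)) := by
  have hslit : ∀ x : ℝ, Complex.I * Complex.exp x - ν ∈ Complex.slitPlane := fun x =>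
    Or.inl (by simpa [Complex.exp_im] using hν)
  have hslit' : ∀ x : ℝ, -(Complex.I * Complex.exp x) - ν ∈ Complex.slitPlane := fun x =>
    Or.inl (by simpa [Complex.exp_im] using hν)
  refine ⟨fun x => (π : ℂ)⁻¹ * Complex.I * (Complex.log (Complex.I * Complex.exp x - ν) -
    Complex.log (-(Complex.I * Complex.exp x) - ν)), fun x => ?_, ?_, ?_⟩
  · refine ((((hasDerivAt_I_mul_exp ν x).clog_real (hslit x)).fun_sub
      ((hasDerivAt_neg_I_mul_exp ν x).clog_real (hslit' x))).const_mul _).congr_deriv ?_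
    simp only [smul_eq_mul, div_eq_mul_inv]
    linear_combination ((π : ℂ)⁻¹ * Complex.exp x * ((Complex.I * Complex.exp x - ν)⁻¹ +
      (-(Complex.I * Complex.exp x) - ν)⁻¹)) * Complex.I_mul_I
  · have h0 : -ν ∈ Complex.slitPlane := Or.inl (by simpa using hν)
    have h1 : Tendsto (fun x : ℝ => Complex.I * Complex.exp x) atBot (𝓝 0) := by
      simpa using tendsto_ofReal_exp_atBot.const_mul Complex.I
    have h2 := (h1.sub_const ν).clog (by simpa using h0)
    have h3 := (h1.neg.sub_const ν).clog (by simpa using h0)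
    simpa using (h2.sub h3).const_mul ((π : ℂ)⁻¹ * Complex.I)
  · have h0 : Tendsto (fun x : ℝ => ν * Complex.exp (-x : ℝ)) atTop (𝓝 0) := by
      simpa using (tendsto_ofReal_exp_atBot.comp tendsto_neg_atTop_atBot).const_mul ν
    -- Factoring out `e^x` isolates the divergent term `x`, which cancels between the two
    -- logarithms.
    have hlog : ∀ (u : ℂ) (x : ℝ), u - ν * Complex.exp (-x : ℝ) ≠ 0 →
        Complex.log (u * Complex.exp x - ν) = x + Complex.log (u - ν * Complex.exp (-x : ℝ)) := by
      intro u x hne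
      have h4 := Complex.log_ofReal_mul (Real.exp_pos x) hne
      rw [Real.log_exp, Complex.ofReal_exp] at h4
      rw [← h4, mul_sub, mul_left_comm, ← Complex.exp_add]
      simp [mul_comm]
    have hne : ∀ u : ℂ, u ∈ ({Complex.I, -Complex.I} : Set ℂ) → ∀ x : ℝ,
        u - ν * Complex.exp (-x : ℝ) ≠ 0 := by
      intro u hu x h
      have h5 := congrArg Complex.re h
      have h6 : u.re = 0 := by rcases hu with rfl | rfl <;> simp
      rw [← Complex.ofReal_exp, Complex.sub_re, h6, Complex.re_mul_ofReal,
        Complex.zero_re] at h5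
      nlinarith [Real.exp_pos (-x), mul_neg_of_neg_of_pos hν (Real.exp_pos (-x))]
    have h1 : Tendsto (fun x : ℝ => Complex.log (Complex.I - ν * Complex.exp (-x : ℝ))) atTop
        (𝓝 (Complex.log Complex.I)) := by
      simpa using (h0.const_sub Complex.I).clog (by simp [Complex.slitPlane])
    have h2 : Tendsto (fun x : ℝ => Complex.log (-Complex.I - ν * Complex.exp (-x : ℝ))) atTop
        (𝓝 (Complex.log (-Complex.I))) := by
      simpa using (h0.const_sub (-Complex.I)).clog (by simp [Complex.slitPlane])
    have h3 := (h1.sub h2).const_mul ((π : ℂ)⁻¹ * Complex.I)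
    have h7 : (π : ℂ)⁻¹ * Complex.I * (Complex.log Complex.I - Complex.log (-Complex.I)) = -1 := by
      rw [Complex.log_I, Complex.log_neg_I]
      have : (π : ℂ) ≠ 0 := by exact_mod_cast pi_ne_zero
      field_simp
      linear_combination 2 * Complex.I_mul_I
    rw [h7] at h3
    refine h3.congr fun x => ?_
    rw [hlog Complex.I x (hne _ (by simp) x), ← neg_mul,
      hlog (-Complex.I) x (hne _ (by simp) x)]
    ring

theorem primitive_inv (hν : ν.re ≠ 0) :
    ∃ Φ : ℝ → ℂ,
      (∀ x : ℝ, HasDerivAt Φ (-(((π : ℂ)⁻¹ * Complex.exp x) •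
        ((Complex.I * Complex.exp x - ν)⁻¹ + (-(Complex.I * Complex.exp x) - ν)⁻¹))) x) ∧
      Tendsto Φ atBot (𝓝 0) ∧ Tendsto Φ atTop (𝓝 (halfPlaneSign ν)) := by
  rcases hν.lt_or_gt with h | h
  · rw [halfPlaneSign, if_neg h.not_gt, if_pos h]
    exact primitive_inv_of_re_neg h
  · rw [halfPlaneSign, if_pos h]
    -- Replacing `ν` by `-ν` exchanges the two summands up to sign, so the integrand is odd in `ν`.
    obtain ⟨Φ, hd, hb, ht⟩ := primitive_inv_of_re_neg (ν := -ν) (by simpa using h)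
    refine ⟨fun x => -Φ x, fun x => (hd x).fun_neg.congr_deriv ?_, by simpa using hb.neg,
      by simpa using ht.neg⟩
    have e1 : Complex.I * Complex.exp x - -ν = -(-(Complex.I * Complex.exp x) - ν) := by ring
    have e2 : -(Complex.I * Complex.exp x) - -ν = -(Complex.I * Complex.exp x - ν) := by ring
    rw [e1, e2, inv_neg, inv_neg]
    simp only [smul_eq_mul]
    ring

end Primitives

theorem signFormula_inv_pow {s : Finset ℂ} (hs : ∀ μ ∈ s, μ.re ≠ 0) {ν : ℂ} (hν : ν ∈ s) (j : ℕ) :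
    ∃ l : ℂ, SignFormula s (fun z => (z - ν)⁻¹ ^ (j + 1)) l := by
  have hd : ∀ k : ℕ, DifferentiableOn ℂ (fun z : ℂ => (z - ν)⁻¹ ^ k) {ν}ᶜ := fun k =>
    DifferentiableOn.fun_pow (DifferentiableOn.fun_inv (by fun_prop) fun z hz => sub_ne_zero.2 hz) k
  have h2 : (2 * (π : ℂ) * Complex.I) ≠ 0 := Complex.two_pi_I_ne_zero
  rcases Nat.eq_zero_or_pos j with rfl | hj
  · refine ⟨halfPlaneSign ν, by simpa using primitive_inv (hs ν hν), ?_⟩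
    filter_upwards [eventually_cycle_eq hs hν (hd 1) (c := 2 * π * Complex.I) fun r hr => by
      simpa using circleIntegral.integral_sub_inv_of_mem_ball (Metric.mem_ball_self hr)]
      with r ⟨hr1, hr2⟩
    refine ⟨hr1, ?_⟩
    rw [hr2, smul_eq_mul, mul_comm, mul_assoc, mul_inv_cancel₀ h2, mul_one]
  · refine ⟨0, primitive_inv_pow (hs ν hν) hj.ne', ?_⟩
    filter_upwards [eventually_cycle_eq hs hν (hd (j + 1)) (c := 0) fun r hr => by
      have := circleIntegral.integral_sub_zpow_of_ne (n := -((j + 1 : ℕ) : ℤ)) (by omega) ν ν r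
      simpa only [zpow_neg, zpow_natCast, ← inv_pow] using this] with r ⟨hr1, hr2⟩
    exact ⟨hr1, by rw [hr2]; simp⟩

end SignFormula

/-! ### Partial fractions of the resolvent. -/

section PartialFractions

variable {E : Type*} [AddCommGroup E] [Module ℂ E]

/-- Sums of the functions `(z - ν)^{-(j+1)} • A` with `ν ∈ s`. -/
def polarParts (E : Type*) [AddCommGroup E] [Module ℂ E] (s : Set ℂ) : AddSubmonoid (ℂ → E) :=
  AddSubmonoid.closure {G | ∃ ν ∈ s, ∃ (j : ℕ) (A : E), G = fun z => (z - ν)⁻¹ ^ (j + 1) • A}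

/-- For `μ ≠ ν`, the identity `(z-μ)⁻¹ (z-ν)⁻¹ = (μ-ν)⁻¹ ((z-μ)⁻¹ - (z-ν)⁻¹)` lowers `k` by one. -/
theorem exists_polarParts_inv_smul_inv_pow {s : Set ℂ} {μ ν : ℂ} (hμ : μ ∈ s) (hν : ν ∈ s) (k : ℕ)
    (A : E) : ∃ G ∈ polarParts E s, ∀ z ∉ s, G z = (z - μ)⁻¹ • (z - ν)⁻¹ ^ k • A := by
  by_cases hμν : μ = ν
  · subst hμν
    refine ⟨_, AddSubmonoid.subset_closure ⟨μ, hμ, k, A, rfl⟩, fun z _ => ?_⟩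
    simp only [pow_succ', mul_smul]
  induction k generalizing A with
  | zero => exact ⟨_, AddSubmonoid.subset_closure ⟨μ, hμ, 0, A, rfl⟩, fun z _ => by simp⟩
  | succ k ih =>
    obtain ⟨G, hG, hGz⟩ := ih ((μ - ν)⁻¹ • A)
    refine ⟨_, add_mem hG
      (AddSubmonoid.subset_closure ⟨ν, hν, k, (-(μ - ν)⁻¹) • A, rfl⟩), fun z hz => ?_⟩
    rw [Pi.add_apply, hGz z hz]
    simp only [smul_smul]
    rw [← add_smul]
    congr 1
    have h1 : z - μ ≠ 0 := sub_ne_zero.2 fun h => hz (h ▸ hμ)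
    have h2 : z - ν ≠ 0 := sub_ne_zero.2 fun h => hz (h ▸ hν)
    have h3 : μ - ν ≠ 0 := sub_ne_zero.2 hμν
    simp only [inv_pow]
    field_simp
    ring

theorem exists_polarParts_inv_smul {s : Set ℂ} {μ : ℂ} (hμ : μ ∈ s) {G : ℂ → E}
    (hG : G ∈ polarParts E s) : ∃ H ∈ polarParts E s, ∀ z ∉ s, H z = (z - μ)⁻¹ • G z := by
  induction hG using AddSubmonoid.closure_induction with
  | mem G hG =>
    obtain ⟨ν, hν, j, A, rfl⟩ := hG
    exact exists_polarParts_inv_smul_inv_pow hμ hν (j + 1) A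
  | zero => exact ⟨0, zero_mem _, fun z _ => by simp⟩
  | add G G' _ _ h h' =>
    obtain ⟨H, hH, e⟩ := h
    obtain ⟨H', hH', e'⟩ := h'
    exact ⟨H + H', add_mem hH hH', fun z hz => by simp [e z hz, e' z hz]⟩

-- Induction on the linear factors through `R B = (z-μ)⁻¹ (B + R (M-μ) B)`, where `R` is the
-- resolvent: `(M-μ) B` is annihilated by the remaining factors, and with no factor left `B = 0`.
open Polynomial in
theorem exists_polarParts_resolvent_mul {n : ℕ} (M : Matrix (Fin n) (Fin n) ℂ) (m : Multiset ℂ)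
    (hm : ∀ μ ∈ m, μ ∈ spectrum ℂ M) (B : Matrix (Fin n) (Fin n) ℂ)
    (hB : aeval M (m.map fun μ => X - C μ).prod * B = 0) :
    ∃ G ∈ polarParts (Matrix (Fin n) (Fin n) ℂ) (spectrum ℂ M), ∀ z ∉ spectrum ℂ M,
      (z • (1 : Matrix (Fin n) (Fin n) ℂ) - M)⁻¹ * B = G z := by
  induction m using Multiset.induction_on generalizing B with
  | empty => exact ⟨0, zero_mem _, fun z _ => by simp_all⟩
  | cons μ m ih =>
    have hμ := hm μ (Multiset.mem_cons_self μ m)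
    obtain ⟨G, hG, hGz⟩ := ih (fun ν hν => hm ν (Multiset.mem_cons_of_mem hν))
      ((M - μ • 1) * B) (by
        rw [Multiset.map_cons, Multiset.prod_cons, mul_comm, map_mul] at hB
        simpa [Algebra.algebraMap_eq_smul_one, mul_assoc] using hB)
    obtain ⟨H, hH, hHz⟩ := exists_polarParts_inv_smul hμ hG
    refine ⟨_, add_mem (AddSubmonoid.subset_closure ⟨μ, hμ, 0, B, rfl⟩) hH, fun z hz => ?_⟩
    have hu : IsUnit (z • (1 : Matrix (Fin n) (Fin n) ℂ) - M) := by
      simpa [spectrum.mem_iff, Algebra.algebraMap_eq_smul_one] using hz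
    have hzμ : z - μ ≠ 0 := sub_ne_zero.2 fun h => hz (h ▸ hμ)
    rw [Pi.add_apply, hHz z hz, ← hGz z hz]
    simp only [zero_add, pow_one]
    rw [← smul_add, eq_inv_smul_iff₀ hzμ]
    set R := (z • (1 : Matrix (Fin n) (Fin n) ℂ) - M)⁻¹ with hR
    have hRi : R * (z • 1 - M) = 1 :=
      Matrix.nonsing_inv_mul _ ((Matrix.isUnit_iff_isUnit_det _).1 hu)
    have h1 : (z - μ) • B = (z • 1 - M) * B + (M - μ • 1) * B := by
      rw [← add_mul, sub_add_sub_cancel, ← sub_smul, smul_one_mul]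
    rw [← mul_smul_comm, h1, mul_add, ← mul_assoc, hRi, one_mul]

theorem exists_polarParts_resolvent {n : ℕ} (M : Matrix (Fin n) (Fin n) ℂ) :
    ∃ G ∈ polarParts (Matrix (Fin n) (Fin n) ℂ) (spectrum ℂ M), ∀ z ∉ spectrum ℂ M,
      (z • (1 : Matrix (Fin n) (Fin n) ℂ) - M)⁻¹ = G z := by
  simpa using exists_polarParts_resolvent_mul M M.charpoly.roots
    (fun μ hμ => Matrix.mem_spectrum_iff_isRoot_charpoly.2 (Polynomial.isRoot_of_mem_roots hμ)) 1
    (by rw [← (IsAlgClosed.splits M.charpoly).eq_prod_roots_of_monic M.charpoly_monic,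
      Matrix.aeval_self_charpoly, zero_mul])

end PartialFractions

theorem exists_signFormula {E : Type*} [NormedAddCommGroup E] [NormedSpace ℂ E] [CompleteSpace E]
    {s : Finset ℂ} (hs : ∀ μ ∈ s, μ.re ≠ 0) {G : ℂ → E} (hG : G ∈ polarParts E (s : Set ℂ)) :
    ∃ L, SignFormula s G L := by
  induction hG using AddSubmonoid.closure_induction with
  | mem G hG =>
    obtain ⟨ν, hν, j, A, rfl⟩ := hG
    obtain ⟨l, hl⟩ := signFormula_inv_pow hs hν j
    exact ⟨_, hl.smul_const A⟩
  | zero => exact ⟨0, .zero s⟩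
  | add G G' _ _ h h' =>
    obtain ⟨L, hL⟩ := h
    obtain ⟨L', hL'⟩ := h'
    exact ⟨_, hL.add hL'⟩

/-! ### Identification of the sign with the line integral. -/

section MatrixSign

variable {n : ℕ} {M : Matrix (Fin n) (Fin n) ℂ} {a γ : ℝ}

theorem matrixSign_eq_integral (ha : 0 < a) (hres : StripResolventBound M a γ)
    (hint : Integrable fun x : ℝ => logIntegrand M x) :
    matrixSign M = ∫ x : ℝ, logIntegrand M x := by
  obtain ⟨s, hsM⟩ : ∃ s : Finset ℂ, (s : Set ℂ) = spectrum ℂ M :=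
    ⟨M.finite_spectrum.toFinset, by simp⟩
  have hunit : ∀ z : ℂ, z ∉ spectrum ℂ M ↔ IsUnit (z • (1 : Matrix (Fin n) (Fin n) ℂ) - M) := by
    simp [spectrum.mem_iff, Algebra.algebraMap_eq_smul_one]
  have him : ∀ z : ℂ, z.re = 0 → z ∉ spectrum ℂ M := fun z hz =>
    (hunit z).2 (hres z (by simpa [hz] using ha.le)).1
  have hs : ∀ μ ∈ s, μ.re ≠ 0 := fun μ hμ h => him μ h (hsM ▸ hμ)
  obtain ⟨G, hG, hGz⟩ := exists_polarParts_resolvent M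
  rw [← hsM] at hG
  obtain ⟨L, ⟨Φ, hd, hb, ht⟩, hc⟩ := exists_signFormula hs hG
  have h1 : ∫ x : ℝ, logIntegrand M x = L := by
    rw [integral_of_hasDerivAt_of_tendsto (fun x => (hd x).congr_deriv ?_) hint hb ht, sub_zero]
    have hre : (Complex.I * Complex.exp x).re = 0 := by simp [Complex.exp_im]
    have hz1 := him _ hre
    have hz2 := him (-(Complex.I * Complex.exp x)) (by rw [Complex.neg_re, hre, neg_zero])
    rw [logIntegrand, sub_smul_one_eq_neg, add_smul_one_eq_neg,
      inv_neg_eq_neg_inv ((hunit _).1 hz1), inv_neg_eq_neg_inv ((hunit _).1 hz2), hGz _ hz1,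
      hGz _ hz2, ← neg_add, smul_neg]
  rw [h1]
  -- The cycle integral equals `L` for all small radii, so its limit is `L`.
  refine Tendsto.limUnder_eq (tendsto_const_nhds.congr' ?_)
  filter_upwards [hc, eventually_small_radius s hs] with r ⟨_, hr⟩ ⟨hr0, hr'⟩
  rw [dunfordIntegral, ← hr, ← hsM, finsum_mem_coe_finset]
  congr 1
  refine Finset.sum_congr rfl fun μ hμ => circleIntegral.integral_congr hr0.le fun z hz => ?_
  have hzs : z ∉ spectrum ℂ M := hsM ▸ notMem_of_mem_sphere hr0 (hr' μ hμ).2 hz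
  simp only [hGz z hzs]

end MatrixSign

/-! ### The regime `Kh ≤ log 2`. -/

section SmallStep

variable {n : ℕ} {M : Matrix (Fin n) (Fin n) ℂ} {a γ β : ℝ}

theorem norm_logIntegrand_ofReal_le (ha : 0 < a) (hres : StripResolventBound M a γ) (x : ℝ) :
    ‖logIntegrand M x‖ ≤ 2 * γ / π * Real.exp x := by
  simpa using norm_logIntegrand_le_of_exp_mul_sin_le hres (z := (x : ℂ)) (by simpa using ha.le)

theorem norm_logIntegrand_ofReal_le_of_nonpos (ha : 0 < a) (hres : StripResolventBound M a γ)
    {x : ℝ} (hx : x ≤ 0) : ‖logIntegrand M x‖ ≤ 2 * γ / π := by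
  have hγ := nonneg_of_stripResolventBound ha hres
  exact (norm_logIntegrand_ofReal_le ha hres x).trans
    (mul_le_of_le_one_right (by positivity) (Real.exp_le_one_iff.2 hx))

/-- The geometric mean of the two bounds for the integrand, near the origin. -/
theorem norm_logIntegrand_ofReal_le_rpow (hM : ‖M‖ ≤ 1) (ha : 0 < a)
    (hres : StripResolventBound M a γ) {x : ℝ} (hx : 0 < x) (hx2 : x ≤ Real.log 2) :
    ‖logIntegrand M x‖ ≤ 2 / π * √γ * x ^ (-(1 / 2) : ℝ) := by
  have hγ := nonneg_of_stripResolventBound ha hres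
  have h1 := norm_logIntegrand_ofReal_le ha hres x
  have h2 := norm_logIntegrand_le_of_re_pos hM (z := (x : ℂ)) (by simpa using hx)
  rw [Complex.ofReal_re] at h2
  set t := Real.exp x
  have ht : 1 < t := Real.one_lt_exp_iff.2 hx
  have ht2 : t ^ 2 = Real.exp (2 * x) := by rw [← Real.exp_nat_mul]; norm_num
  have hq := Real.quadratic_le_exp_of_nonneg (x := 2 * x) (by linarith)
  rw [← ht2] at hq
  have hx7 : x ≤ 0.6931471808 := hx2.trans Real.log_two_lt_d9.le
  -- Equivalent to `(1 - x) e^{2x} ≥ 1`; the quadratic Taylor bound gives `1 + x - 2x³`, enough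
  -- since `x² ≤ 1/2` on this range.
  have hkey : x * t ^ 2 ≤ t ^ 2 - 1 := by
    have h3 : 1 ≤ (1 - x) * (1 + 2 * x + (2 * x) ^ 2 / 2) := by nlinarith
    nlinarith
  have hr : 0 ≤ 2 / π * √γ * x ^ (-(1 / 2) : ℝ) := by positivity
  refine abs_le_of_sq_le_sq' ?_ hr |>.2
  have hsq : (x ^ (-(1 / 2) : ℝ)) ^ 2 = x⁻¹ := by
    rw [← Real.rpow_natCast, ← Real.rpow_mul hx.le, ← Real.rpow_neg_one]; norm_num
  have hfrac : t * (t / (t ^ 2 - 1)) ≤ x⁻¹ := by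
    rw [← mul_div_assoc, ← sq, div_le_iff₀ (by nlinarith), inv_mul_eq_div, le_div_iff₀ hx]
    linarith
  calc ‖logIntegrand M x‖ ^ 2
      ≤ (2 * γ / π * t) * (2 / π * (t / (t ^ 2 - 1))) := by
        rw [sq]; exact mul_le_mul h1 h2 (norm_nonneg _) (by positivity)
    _ = (2 / π) ^ 2 * γ * (t * (t / (t ^ 2 - 1))) := by ring
    _ ≤ (2 / π) ^ 2 * γ * x⁻¹ := mul_le_mul_of_nonneg_left hfrac (by positivity)
    _ = (2 / π * √γ * x ^ (-(1 / 2) : ℝ)) ^ 2 := by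
        rw [mul_pow, mul_pow, Real.sq_sqrt hγ, hsq]

/-- The line is cut at `0` and `log 2`, with majorants proportional to `e^x`, `x^{-1/2}` and
`e^{-x}`. The square root singularity is integrable, unlike the `1/x` of the resolvent cancellation
bound. -/
theorem norm_integral_logIntegrand_le (hM : ‖M‖ ≤ 1) (ha : 0 < a)
    (hres : StripResolventBound M a γ) (hint : Integrable fun x : ℝ => logIntegrand M x) :
    ‖∫ x : ℝ, logIntegrand M x‖ ≤ 2 / π * (γ + 2 * √γ * √(Real.log 2) + 1) := by
  have hl : 0 < Real.log 2 := Real.log_pos one_lt_two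
  have e : ∫ x : ℝ, logIntegrand M x = (∫ x in Iic (0 : ℝ), logIntegrand M x) +
      (∫ x in (0 : ℝ)..Real.log 2, logIntegrand M x) +
      ∫ x in Ioi (Real.log 2), logIntegrand M x := by
    rw [← intervalIntegral.integral_Iic_sub_Iic hint.integrableOn hint.integrableOn,
      add_sub_cancel, intervalIntegral.integral_Iic_add_Ioi hint.integrableOn hint.integrableOn]
  have h1 : ‖∫ x in Iic (0 : ℝ), logIntegrand M x‖ ≤ 2 * γ / π := by
    refine (norm_integral_le_of_norm_le ((integrableOn_exp_Iic 0).const_mul (2 * γ / π))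
      (ae_of_all _ (norm_logIntegrand_ofReal_le ha hres))).trans_eq ?_
    rw [integral_const_mul, integral_exp_Iic, Real.exp_zero, mul_one]
  have h2 : ‖∫ x in (0 : ℝ)..Real.log 2, logIntegrand M x‖ ≤ 2 / π * √γ * (2 * √(Real.log 2)) := by
    refine (intervalIntegral.norm_integral_le_of_norm_le hl.le
      (g := fun x => 2 / π * √γ * x ^ (-(1 / 2) : ℝ)) (ae_of_all _ fun x hx =>
        norm_logIntegrand_ofReal_le_rpow hM ha hres hx.1 hx.2)
      ((intervalIntegral.intervalIntegrable_rpow' (by norm_num)).const_mul _)).trans_eq ?_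
    rw [intervalIntegral.integral_const_mul, integral_rpow (Or.inl (by norm_num)),
      Real.sqrt_eq_rpow (Real.log 2)]
    norm_num
    left
    ring
  have h3 : ‖∫ x in Ioi (Real.log 2), logIntegrand M x‖ ≤ 2 / π := by
    have hi : IntegrableOn (fun x : ℝ => Real.exp (-x)) (Ioi (Real.log 2)) := by
      simpa using exp_neg_integrableOn_Ioi (Real.log 2) one_pos
    refine (norm_integral_le_of_norm_le (hi.const_mul (2 / π / (1 - Real.exp (-Real.log 2))))
      (ae_restrict_of_forall_mem measurableSet_Ioi fun x hx => ?_)).trans_eq ?_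
    · simpa using norm_logIntegrand_le_exp_neg hM hl (z := (x : ℂ)) (by simpa using (mem_Ioi.1 hx).le)
    · rw [integral_const_mul, integral_exp_neg_Ioi, Real.exp_neg, Real.exp_log two_pos]
      ring
  rw [e]
  refine (norm_add₃_le.trans (add_le_add (add_le_add h1 h2) h3)).trans_eq ?_
  ring

theorem sum_rpow_neg_half_le (K : ℕ) :
    ∑ k ∈ Finset.range K, ((k : ℝ) + 1) ^ (-(1 / 2) : ℝ) ≤ 2 * √K := by
  induction K with
  | zero => simp
  | succ K ih =>
    rw [Finset.sum_range_succ]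
    refine (add_le_add_left ih _).trans ?_
    rw [Real.rpow_neg (by positivity), ← Real.sqrt_eq_rpow, Nat.cast_add_one]
    have h0 : 0 < √((K : ℝ) + 1) := Real.sqrt_pos.2 (by positivity)
    have h1 := Real.sq_sqrt (show (0 : ℝ) ≤ K + 1 by positivity)
    have h2 := Real.sq_sqrt (show (0 : ℝ) ≤ K by positivity)
    rw [← le_sub_iff_add_le', inv_le_iff_one_le_mul₀ h0]
    nlinarith [sq_nonneg (√((K : ℝ) + 1) - √K)]

theorem norm_logSincSum_le (hM : ‖M‖ ≤ 1) (ha : 0 < a) (hres : StripResolventBound M a γ)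
    {h : ℝ} {K : ℕ} (hh : 0 < h) (hKh : K * h ≤ Real.log 2) :
    ‖logSincSum K h M‖ ≤ 2 / π * ((K + 1) * h * γ + 2 * √γ * √(K * h)) := by
  have hp : ∀ k ∈ Finset.range K, ‖logIntegrand M ((((k : ℤ) + 1 : ℤ) * h : ℝ) : ℂ)‖ ≤
      2 / π * √γ * (h ^ (-(1 / 2) : ℝ) * ((k : ℝ) + 1) ^ (-(1 / 2) : ℝ)) := fun k hk => by
    have hk' : (k : ℝ) + 1 ≤ K := by exact_mod_cast Finset.mem_range.1 hk
    refine (norm_logIntegrand_ofReal_le_rpow hM ha hres (by push_cast; positivity) ?_).trans_eq ?_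
    · push_cast
      exact (mul_le_mul_of_nonneg_right hk' hh.le).trans hKh
    · push_cast
      rw [mul_comm ((k : ℝ) + 1), Real.mul_rpow hh.le (by positivity)]
  have hm : ∀ k ∈ Finset.range K, ‖logIntegrand M (((-((k : ℤ) + 1) : ℤ) * h : ℝ) : ℂ)‖ ≤
      2 * γ / π := fun k _ => by
    refine norm_logIntegrand_ofReal_le_of_nonpos ha hres ?_
    push_cast
    nlinarith [(k.cast_nonneg : (0 : ℝ) ≤ k)]
  have h0 : ‖logIntegrand M (((0 : ℤ) * h : ℝ) : ℂ)‖ ≤ 2 * γ / π :=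
    norm_logIntegrand_ofReal_le_of_nonpos ha hres (by simp)
  rw [logSincSum_eq_smul_sum, norm_smul, Complex.norm_real, Real.norm_of_nonneg hh.le, sum_Icc_neg_eq]
  have hsum := norm_add₃_le.trans (add_le_add (add_le_add (norm_sum_le_of_le _ hp) h0)
    (norm_sum_le_of_le _ hm))
  refine (mul_le_mul_of_nonneg_left hsum hh.le).trans ?_
  rw [← Finset.mul_sum, ← Finset.mul_sum, Finset.sum_const, Finset.card_range, nsmul_eq_mul]
  have hhalf : h * h ^ (-(1 / 2) : ℝ) = √h := by
    rw [Real.sqrt_eq_rpow, ← Real.rpow_one_add' hh.le (by norm_num)]; norm_num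
  calc h * (2 / π * √γ * (h ^ (-(1 / 2) : ℝ) *
          ∑ k ∈ Finset.range K, ((k : ℝ) + 1) ^ (-(1 / 2) : ℝ)) + 2 * γ / π + K * (2 * γ / π))
      = 2 / π * ((K + 1) * h * γ + √γ * (h * h ^ (-(1 / 2) : ℝ)) *
          ∑ k ∈ Finset.range K, ((k : ℝ) + 1) ^ (-(1 / 2) : ℝ)) := by ring
    _ ≤ 2 / π * ((K + 1) * h * γ + √γ * √h * (2 * √K)) := by
        rw [hhalf]
        gcongr
        exact sum_rpow_neg_half_le K
    _ = 2 / π * ((K + 1) * h * γ + 2 * √γ * √(K * h)) := by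
        rw [Real.sqrt_mul (by positivity)]; ring

/-- With `u = (a - sin β) / sin β` the bracket in `stripConst` is `(1 + u) γ + 1/u ≥ γ + 2√γ`, which
eliminates `a` and `β`. -/
theorem le_signConst (hγ : 0 ≤ γ) (hβ0 : 0 < β) (hβ : β < Real.arcsin a) :
    2 / π * (5 * γ + 8 * √γ + 2) ≤ signConst β a γ := by
  have hs := sin_pos_of_lt_arcsin hβ0 hβ
  have hsa := sub_pos.2 (sin_lt_of_lt_arcsin hβ0 hβ)
  have key : γ + 2 * √γ ≤ a * γ / Real.sin β + Real.sin β / (a - Real.sin β) := by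
    set u := (a - Real.sin β) / Real.sin β with hu
    have hu0 : 0 < u := div_pos hsa hs
    have e : a * γ / Real.sin β + Real.sin β / (a - Real.sin β) - (γ + 2 * √γ) =
        u * (√γ - u⁻¹) ^ 2 := by
      have h1 : Real.sin β / (a - Real.sin β) = u⁻¹ := by rw [hu, inv_div]
      have h2 : a * γ / Real.sin β = (1 + u) * γ := by rw [hu]; field_simp; ring
      rw [h1, h2, sub_sq, Real.sq_sqrt hγ]
      field_simp
      ring
    have : 0 ≤ u * (√γ - u⁻¹) ^ 2 := by positivity
    linarith
  rw [signConst, stripConst]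
  have hπ : 0 < 2 / π := by positivity
  calc 2 / π * (5 * γ + 8 * √γ + 2)
      = 2 / π * (4 * (γ + 2 * √γ) + γ + 2) := by ring
    _ ≤ 2 / π * (4 * (a * γ / Real.sin β + Real.sin β / (a - Real.sin β)) + γ + 2) := by gcongr
    _ = _ := by ring

theorem norm_integral_sub_logSincSum_le_of_mul_le_log_two (hM : ‖M‖ ≤ 1)
    (hres : StripResolventBound M a γ) (hβ0 : 0 < β) (hβ : β < Real.arcsin a)
    {h : ℝ} {K : ℕ} (hh : 0 < h) (hK : 1 ≤ K) (hKh : K * h ≤ Real.log 2) :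
    ‖(∫ x : ℝ, logIntegrand M x) - logSincSum K h M‖ ≤
      signConst β a γ * Real.exp (-(K * h)) := by
  have ha : 0 < a := (sin_pos_of_lt_arcsin hβ0 hβ).trans (sin_lt_of_lt_arcsin hβ0 hβ)
  have hγ := nonneg_of_stripResolventBound ha hres
  have hK1 : (1 : ℝ) ≤ K := by exact_mod_cast hK
  have hl7 : Real.log 2 ≤ 0.6931471808 := Real.log_two_lt_d9.le
  have h1 := norm_integral_logIntegrand_le hM ha hres (integrable_logIntegrand hβ0 hβ hM hres)
  have h2 := norm_logSincSum_le hM ha hres hh hKh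
  have hsq : √(Real.log 2) ≤ 0.9 := Real.sqrt_le_iff.2 ⟨by norm_num, by linarith⟩
  have hsq' : √(K * h) ≤ 0.9 := (Real.sqrt_le_sqrt hKh).trans hsq
  -- Since `K ≥ 1`, `(K + 1) h ≤ 2Kh ≤ 2 log 2 < 1.4`. The total `2.4γ + 3.6√γ + 1` then fits under
  -- half of `5γ + 8√γ + 2`, the half being the lower bound for `e^{-Kh}`.
  have h3 : (K + 1) * h ≤ 1.4 := by nlinarith
  have hexp : (1 / 2 : ℝ) ≤ Real.exp (-(K * h)) := by
    have := Real.exp_le_exp.2 (neg_le_neg hKh)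
    rwa [Real.exp_neg (Real.log 2), Real.exp_log two_pos, ← one_div] at this
  have hC := le_signConst hγ hβ0 hβ
  have hg := Real.sqrt_nonneg γ
  calc ‖(∫ x : ℝ, logIntegrand M x) - logSincSum K h M‖
      ≤ 2 / π * (γ + 2 * √γ * √(Real.log 2) + 1) +
          2 / π * ((K + 1) * h * γ + 2 * √γ * √(K * h)) := (norm_sub_le _ _).trans (add_le_add h1 h2)
    _ = 2 / π * (γ + (K + 1) * h * γ + 2 * √γ * √(Real.log 2) + 2 * √γ * √(K * h) + 1) := by ring
    _ ≤ 2 / π * (γ + 1.4 * γ + 2 * √γ * 0.9 + 2 * √γ * 0.9 + 1) := by gcongr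
    _ ≤ 2 / π * (5 * γ + 8 * √γ + 2) * (1 / 2) := by
        rw [mul_assoc (2 / π)]
        refine mul_le_mul_of_nonneg_left ?_ (div_pos two_pos pi_pos).le
        linarith
    _ ≤ signConst β a γ * Real.exp (-(K * h)) :=
        mul_le_mul hC hexp (by norm_num)
          (le_trans (mul_nonneg (by positivity) (by positivity)) hC)

end SmallStep

/-! ### The balanced step. -/

section BalancedStep

variable {n : ℕ} {M : Matrix (Fin n) (Fin n) ℂ} {a γ β : ℝ}

theorem signConst_pos (hγ : 0 ≤ γ) (hβ0 : 0 < β) (hβ : β < Real.arcsin a) :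
    0 < signConst β a γ :=
  lt_of_lt_of_le (by positivity) (le_signConst hγ hβ0 hβ)

theorem balancedStep_pos (hβ0 : 0 < β) {K : ℕ} (hK : 1 ≤ K) : 0 < balancedStep β K := by
  have : (0 : ℝ) < K := by exact_mod_cast hK
  exact Real.sqrt_pos.2 (by positivity)

theorem mul_balancedStep {K : ℕ} (hK : 1 ≤ K) :
    K * balancedStep β K = √(2 * π * β * K) := by
  have hK' : (0 : ℝ) < K := by exact_mod_cast hK
  nth_rewrite 1 [balancedStep, ← Real.sqrt_sq hK'.le]
  rw [← Real.sqrt_mul (by positivity)]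
  congr 1
  field_simp

theorem div_balancedStep (hβ0 : 0 < β) {K : ℕ} (hK : 1 ≤ K) :
    2 * π * β / balancedStep β K = √(2 * π * β * K) := by
  have hK' : (0 : ℝ) < K := by exact_mod_cast hK
  rw [div_eq_iff (balancedStep_pos hβ0 hK).ne', balancedStep, ← Real.sqrt_mul (by positivity),
    ← Real.sqrt_sq (show 0 ≤ 2 * π * β by positivity)]
  congr 1
  rw [Real.sqrt_sq (by positivity)]
  field_simp

theorem norm_integral_sub_logSincSum_balancedStep_le (hM : ‖M‖ ≤ 1)
    (hres : StripResolventBound M a γ) (hβ0 : 0 < β) (hβ : β < Real.arcsin a)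
    {K : ℕ} (hK : 1 ≤ K) :
    ‖(∫ x : ℝ, logIntegrand M x) - logSincSum K (balancedStep β K) M‖ ≤
      signConst β a γ * Real.exp (-√(2 * π * β * K)) := by
  have hh := balancedStep_pos hβ0 hK
  rcases le_total (K * balancedStep β K) (Real.log 2) with h | h
  · rw [← mul_balancedStep hK]
    exact norm_integral_sub_logSincSum_le_of_mul_le_log_two hM hres hβ0 hβ hh hK h
  · have hs := sin_pos_of_lt_arcsin hβ0 hβ
    have hsa := sub_pos.2 (sin_lt_of_lt_arcsin hβ0 hβ)
    have ha : 0 < a := by linarith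
    have hγ := nonneg_of_stripResolventBound ha hres
    have hC : 0 ≤ stripConst β a γ := by unfold stripConst; positivity
    refine (norm_integral_sub_logSincSum_le hβ0 hβ hM hres hh hK).trans ?_
    rw [mul_balancedStep hK] at h
    rw [sincError, div_balancedStep hβ0 hK, mul_balancedStep hK]
    set t := Real.exp √(2 * π * β * K) with ht
    have ht2 : 2 ≤ t := by
      have := Real.exp_le_exp.2 h
      rwa [Real.exp_log two_pos] at this
    -- Valid because `t = e^{Kh} ≥ 2`; it doubles `stripConst` and turns `2/π` into `4/π`, as in
    -- `signConst`.
    have hinv : (t - 1)⁻¹ ≤ 2 * t⁻¹ := by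
      rw [inv_le_iff_one_le_mul₀ (by linarith), mul_assoc, inv_mul_eq_div, mul_div_assoc',
        le_div_iff₀ (by linarith)]
      linarith
    rw [Real.exp_neg, ← ht, signConst, div_eq_mul_inv (stripConst β a γ),
      div_eq_mul_inv 2 (π * (t - 1)), mul_inv_rev]
    calc stripConst β a γ * (t - 1)⁻¹ + 2 * γ / π * t⁻¹ + 2 * ((t - 1)⁻¹ * π⁻¹)
        ≤ stripConst β a γ * (2 * t⁻¹) + 2 * γ / π * t⁻¹ + 2 * (2 * t⁻¹ * π⁻¹) := by gcongr
      _ = (2 * stripConst β a γ + (2 * γ + 4) / π) * t⁻¹ := by ring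

theorem sqrt_le_of_sq_div_le (hβ0 : 0 < β) {δ x : ℝ} (hx : 1 / (2 * π * β) * δ ^ 2 ≤ x) :
    δ ≤ √(2 * π * β * x) := by
  refine Real.le_sqrt_of_sq_le ?_
  rwa [one_div, inv_mul_le_iff₀ (by positivity)] at hx

theorem mul_exp_neg_le_of_log_le {C ε s : ℝ} (hC : 0 < C) (hε : 0 < ε) (hs : Real.log (C / ε) ≤ s) :
    C * Real.exp (-s) ≤ ε := by
  rw [Real.log_le_iff_le_exp (by positivity), div_le_iff₀ hε] at hs
  rw [Real.exp_neg, ← div_eq_mul_inv, div_le_iff₀ (Real.exp_pos _)]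
  linarith

end BalancedStep

end LogSinc

/-! ### Assembly of the five claims. -/

theorem mainTheorem5 :
    ∃ c : ℝ, 0 < c ∧
      ∀ (n : ℕ) (M : Matrix (Fin n) (Fin n) ℂ) (a γ β : ℝ),
        ‖M‖ ≤ 1 → 0 < a → a < 1 → LogSinc.StripResolventBound M a γ →
        0 < β → β < Real.arcsin a →
        -- the integrand is well defined and holomorphic on the strip `|Im z| < β`,
        -- and it integrates to the sign
        ((∀ z : ℂ, |z.im| < β →
            IsUnit (M - (Complex.I * Complex.exp z) • (1 : Matrix (Fin n) (Fin n) ℂ)) ∧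
            IsUnit (M + (Complex.I * Complex.exp z) • (1 : Matrix (Fin n) (Fin n) ℂ))) ∧
          DifferentiableOn ℂ (LogSinc.logIntegrand M) {z : ℂ | |z.im| < β} ∧
          MeasureTheory.Integrable (fun x : ℝ => LogSinc.logIntegrand M (x : ℂ)) ∧
          LogSinc.matrixSign M = ∫ x : ℝ, LogSinc.logIntegrand M (x : ℂ)) ∧
        -- the explicit error bound for every step and every number of nodes
        (∀ (h : ℝ) (K : ℕ), 0 < h → 1 ≤ K →
          ‖LogSinc.matrixSign M - LogSinc.logSincSum K h M‖ ≤ LogSinc.sincError K h β a γ) ∧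
        -- the root-exponential bound for the balanced step
        (0 < LogSinc.signConst β a γ ∧
          ∀ K : ℕ, 1 ≤ K →
            ‖LogSinc.matrixSign M - LogSinc.logSincSum K (LogSinc.balancedStep β K) M‖ ≤
              LogSinc.signConst β a γ * Real.exp (-Real.sqrt (2 * Real.pi * β * K))) ∧
        -- the explicit sufficient number of nodes for a target error
        (∀ (ε : ℝ) (K : ℕ), 0 < ε →
          ⌈1 / (2 * Real.pi * β) *
              max (Real.log 2 ^ 2) (Real.log (1 + LogSinc.signConst β a γ / ε) ^ 2)⌉₊ ≤ K →
          ‖LogSinc.matrixSign M - LogSinc.logSincSum K (LogSinc.balancedStep β K) M‖ ≤ ε) ∧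
        -- the asymptotic form of the sufficient number of nodes, with an absolute constant `c`
        (∀ ε : ℝ, 0 < ε →
          ∃ K₀ : ℕ, 1 ≤ K₀ ∧
            (K₀ : ℝ) ≤ max 1 (c * (1 / β * Real.log (LogSinc.signConst β a γ / ε) ^ 2)) ∧
            ∀ K : ℕ, K₀ ≤ K →
              ‖LogSinc.matrixSign M - LogSinc.logSincSum K (LogSinc.balancedStep β K) M‖ ≤ ε) := by
  -- The constant is twice `1 / (2π)`: the threshold `x` is rounded up, and `⌈x⌉ ≤ 2x` once `x ≥ 1`.
  refine ⟨1 / Real.pi, by positivity, fun n M a γ β hM ha _ hres hβ0 hβ => ?_⟩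
  have hγ := LogSinc.nonneg_of_stripResolventBound ha hres
  have hint := LogSinc.integrable_logIntegrand hβ0 hβ hM hres
  have hsign := LogSinc.matrixSign_eq_integral ha hres hint
  have hC := LogSinc.signConst_pos hγ hβ0 hβ
  have hsin := (LogSinc.sin_lt_of_lt_arcsin hβ0 hβ).le
  have hbal : ∀ K : ℕ, 1 ≤ K →
      ‖LogSinc.matrixSign M - LogSinc.logSincSum K (LogSinc.balancedStep β K) M‖ ≤
        LogSinc.signConst β a γ * Real.exp (-Real.sqrt (2 * Real.pi * β * K)) := fun K hK => by
    rw [hsign]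
    exact LogSinc.norm_integral_sub_logSincSum_balancedStep_le hM hres hβ0 hβ hK
  have htarget : ∀ (ε : ℝ) (K : ℕ), 0 < ε → 1 ≤ K →
      Real.log (LogSinc.signConst β a γ / ε) ≤ Real.sqrt (2 * Real.pi * β * K) →
      ‖LogSinc.matrixSign M - LogSinc.logSincSum K (LogSinc.balancedStep β K) M‖ ≤ ε :=
    fun ε K hε hK h => (hbal K hK).trans (LogSinc.mul_exp_neg_le_of_log_le hC hε h)
  refine ⟨⟨fun z hz => ?_, ?_, hint, hsign⟩, fun h K hh hK => ?_, ⟨hC, hbal⟩, fun ε K hε hK => ?_,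
    fun ε hε => ?_⟩
  · exact LogSinc.isUnit_sub_and_add hM hres ((LogSinc.abs_sin_le_of_abs_le hβ hz.le).trans hsin)
  · exact (LogSinc.differentiableOn_logIntegrand hM hres hβ0 hβ).mono fun z (hz : |z.im| < β) => hz.le
  · rw [hsign]
    exact LogSinc.norm_integral_sub_logSincSum_le hβ0 hβ hM hres hh hK
  · have hK' := Nat.ceil_le.1 hK
    -- The entry `(log 2)²` of the maximum makes the threshold positive and so excludes `K = 0`.
    have hK1 : 1 ≤ K := by
      refine Nat.one_le_iff_ne_zero.2 fun h0 => ?_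
      rw [h0, Nat.cast_zero] at hK'
      have h1 : 0 < Real.log 2 := Real.log_pos one_lt_two
      have h2 : 0 < max (Real.log 2 ^ 2) (Real.log (1 + LogSinc.signConst β a γ / ε) ^ 2) :=
        lt_max_of_lt_left (by positivity)
      have h3 : 0 < 1 / (2 * Real.pi * β) *
          max (Real.log 2 ^ 2) (Real.log (1 + LogSinc.signConst β a γ / ε) ^ 2) := by positivity
      linarith
    refine htarget ε K hε hK1 (le_trans (Real.log_le_log (by positivity) (by linarith))
      (LogSinc.sqrt_le_of_sq_div_le (δ := Real.log (1 + LogSinc.signConst β a γ / ε)) hβ0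
        (le_trans ?_ hK')))
    exact mul_le_mul_of_nonneg_left (le_max_right _ _) (by positivity)
  · set x := 1 / (2 * Real.pi * β) * Real.log (LogSinc.signConst β a γ / ε) ^ 2 with hx
    have hx0 : 0 ≤ x := by positivity
    refine ⟨max 1 ⌈x⌉₊, le_max_left _ _, ?_, fun K hK => ?_⟩
    · have hc : 1 / Real.pi * (1 / β * Real.log (LogSinc.signConst β a γ / ε) ^ 2) = 2 * x := by
        rw [hx]; field_simp
      rw [hc, Nat.cast_max, Nat.cast_one]
      refine max_le (le_max_left _ _) ?_
      rcases le_total x 1 with h | h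
      · exact le_max_of_le_left (by exact_mod_cast Nat.ceil_le.2 (by simpa using h))
      · exact le_max_of_le_right (by linarith [Nat.ceil_lt_add_one hx0])
    · exact htarget ε K hε ((le_max_left _ _).trans hK) (LogSinc.sqrt_le_of_sq_div_le hβ0
        (Nat.ceil_le.1 ((le_max_right _ _).trans hK)))
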